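/- **Setting.** Let $n\ge 1$ and let $v_1,\dots,v_m\in\mathbb R^n$, $\alpha_1,\dots,\alpha_m>0$, and transition rates $A^{ij}_{kl}\ge 0$ $(i,j,k,l=1,\dots,m)$ be given, with the symmetries $$A^{ij}_{lk}=A^{ij}_{kl}=A^{ji}_{kl}=A^{kl}_{ij}. \qquad (1.3)$$ For $F,G\in\mathbb R^m$ put $$Q_i(F,G)=\frac1{2\alpha_i}\sum_{j,k,l}\bigl\{A^{ij}_{kl}(F_kG_l+F_lG_k)-A^{kl}_{ij}(F_iG_j+F_jG_i)\bigr\}.$$ Let $M\in\mathbb R^m$ be an absolute Maxwellian, i.e. $M_i>0$ and $A^{ij}_{kl}(M_iM_j-M_kM_l)=0$ for all $i,j,k,l$. Put $\Lambda=\mathrm{diag}(M_1/\alpha_1,\dots,M_m/\alpha_m)$, $Lf=-2\Lambda^{-1/2}Q(M,\Lambda^{1/2}f)$, $\Gamma(f,g)=\Lambda^{-1/2}Q(\Lambda^{1/2}f,\Lambda^{1/2}g)$ and $V^j=\mathrm{diag}(v_1^j,\dots,v_m^j)$, where $v_i=(v_i^1,\dots,v_i^n)$. For $\varepsilon>0$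 consider the problem for $f_\varepsilon=f_\varepsilon(t,x)\in\mathbb R^m$ $$\partial_t f_\varepsilon+\frac1\varepsilon\sum_{j=1}^nV^j\partial_{x_j}f_\varepsilon+\frac1{\varepsilon^2}Lf_\varepsilon=\frac1\varepsilon\Gamma(f_\varepsilon,f_\varepsilon),\qquad f_\varepsilon(0,x)=f_0(x). \qquad (1.5)$$ $H^s=H^s(\mathbb R^n;\mathbb R^m)$ is the $L^2$-Sobolev space of real order $s$, with norm $\|u\|_s=\|(1-\Delta)^{s/2}u\|_{L^2}$. $L^\infty([0,T],X)$ and $C([0,T],X)$ are the bounded and the continuous functions on $[0,T]$ with values in $X$. The differential equation is understood in the sense of tempered distributions in $x$, at every $t\in[0,T]$: for every Schwartz function $\varphi:\mathbb R^n\to\mathbb R^m$, the function $t\mapsto\int\langle f_\varepsilon(t,x),\varphi(x)\rangle\,dx$ is differentiable on $[0,T]$ (one-sidedly at the end points), with the derivative given by the equation after the $x$-derivatives have been moved to $\varphi$. **Theorem 1.** Let $l>\frac n2$ be real. Then there are $T_0>0$ and $k>0$, which for the given model, $M$, $n$ and $l$ depend only on $\|f_0\|_l$, such that for every $f_0\in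 H^l$ and every $\varepsilon>0$ the problem (1.5) has a unique solution $f_\varepsilon$ in $L^\infty([0,T_0],H^l)\cap C([0,T_0],H^{l-1})$, and this solution satisfies $\|f_\varepsilon(t)\|_l\le k$ for all $t\in[0,T_0]$. In particular neither $T_0$ nor $k$ depends on $\varepsilon$. -/

import Mathlib

open MeasureTheory Set Filter Topology
open scoped ENNReal NNReal SchwartzMap FourierTransform

noncomputable section

namespace DiscreteBoltzmann

/-- Physical space `ℝⁿ`. -/
abbrev Space (n : ℕ) := EuclideanSpace ℝ (Fin n)

/-- State space `ℝᵐ`, one coordinate for each admissible velocity. -/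
abbrev State (m : ℕ) := EuclideanSpace ℝ (Fin m)

/-- Square-integrable fields `ℝⁿ → ℝᵐ` (modulo equality almost everywhere). -/
abbrev L2Field (n m : ℕ) := Lp (State m) 2 (volume : Measure (Space n))

/-! ### Discrete velocity models -/

/-- The data of a discrete velocity model with `m` velocities in `ℝⁿ`:
the velocities `v i`, the positive constants `α i`, and the nonnegative transition rates,
`A i j k l` standing for the rate with upper indices `i j` and lower indices `k l`. -/
structure Model (n m : ℕ) where
  v : Fin m → Space n
  α : Fin m → ℝ
  α_pos : ∀ i, 0 < α i
  A : Fin m → Fin m → Fin m → Fin m → ℝ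
  A_nonneg : ∀ i j k l, 0 ≤ A i j k l

variable {n m : ℕ}

namespace Model

/-- Indistinguishability of the particles and reversibility of the collisions. -/
structure SymmetricRates (B : Model n m) : Prop where
  swap_lower : ∀ i j k l, B.A i j l k = B.A i j k l
  swap_upper : ∀ i j k l, B.A j i k l = B.A i j k l
  reverse : ∀ i j k l, B.A k l i j = B.A i j k l

/-- The bilinear collision operator
`Q_i(F,G) = (1/(2α_i)) ∑_{jkl} {A^{ij}_{kl}(F_k G_l + F_l G_k) - A^{kl}_{ij}(F_i G_j + F_j G_i)}`. -/
def Q (B : Model n m) (F G : State m) : State m :=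
  WithLp.toLp 2 fun i => 1 / (2 * B.α i) * ∑ j, ∑ k, ∑ l,
    (B.A i j k l * (F k * G l + F l * G k) - B.A k l i j * (F i * G j + F j * G i))

/-- `M` is an absolute Maxwellian: a positive constant state with
`A^{ij}_{kl} (M_i M_j - M_k M_l) = 0`. -/
structure IsMaxwellian (B : Model n m) (M : State m) : Prop where
  pos : ∀ i, 0 < M i
  balance : ∀ i j k l, B.A i j k l * (M i * M j - M k * M l) = 0

/-- `Λ^{1/2} f`, where `Λ = diag (M_i / α_i)`. -/
def sqrtΛ (B : Model n m) (M f : State m) : State m :=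
  WithLp.toLp 2 fun i => √(M i / B.α i) * f i

/-- `Λ^{-1/2} f`, where `Λ = diag (M_i / α_i)`. -/
def invSqrtΛ (B : Model n m) (M f : State m) : State m :=
  WithLp.toLp 2 fun i => (√(M i / B.α i))⁻¹ * f i

/-- The linearized collision operator `L f = -2 Λ^{-1/2} Q(M, Λ^{1/2} f)`. -/
def L (B : Model n m) (M f : State m) : State m :=
  (-2 : ℝ) • B.invSqrtΛ M (B.Q M (B.sqrtΛ M f))

/-- `Γ(f,g) = Λ^{-1/2} Q(Λ^{1/2} f, Λ^{1/2} g)`. -/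
def Γ (B : Model n m) (M f g : State m) : State m :=
  B.invSqrtΛ M (B.Q (B.sqrtΛ M f) (B.sqrtΛ M g))

end Model

/-! ### Sobolev spaces of real order -/

/-- The inclusion `ℝᵐ → ℂᵐ`. -/
def stateToComplex (m : ℕ) : State m →L[ℝ] EuclideanSpace ℂ (Fin m) :=
  LinearMap.toContinuousLinearMap
    { toFun := fun x => WithLp.toLp 2 fun i => (x i : ℂ)
      map_add' := fun x y => by ext i; simp
      map_smul' := fun c x => by ext i; simp }

/-- The Fourier transform (with kernel `e^{-2πi⟨x,ξ⟩}`) of a real square-integrable field. -/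
def fourierL2 (u : L2Field n m) : Lp (EuclideanSpace ℂ (Fin m)) 2 (volume : Measure (Space n)) :=
  𝓕 ((stateToComplex m).compLp u)

/-- The Sobolev norm `‖u‖_s = ‖(1 - Δ)^{s/2} u‖_{L²} = ‖(1 + |2πξ|²)^{s/2} û‖_{L²}` of order `s`,
with the value `∞` if `u` is not in `H^s`. -/
def sobolevNorm (s : ℝ) (u : L2Field n m) : ℝ≥0∞ :=
  eLpNorm (fun ξ : Space n =>
    ((1 + ‖(2 * Real.pi) • ξ‖ ^ 2) ^ (s / 2) : ℝ) • fourierL2 u ξ) 2 volume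

/-- `u ∈ H^s`. -/
def MemH (s : ℝ) (u : L2Field n m) : Prop := sobolevNorm s u < ∞

/-- `u : [0,T] → H^s` is bounded. -/
def BoundedInH (s T : ℝ) (u : ℝ → L2Field n m) : Prop :=
  ∃ K : ℝ≥0, ∀ t ∈ Icc 0 T, sobolevNorm s (u t) ≤ K

/-- `u : [0,T] → H^s` is continuous for the norm of `H^s`. -/
def ContinuousInH (s T : ℝ) (u : ℝ → L2Field n m) : Prop :=
  (∀ t ∈ Icc 0 T, MemH s (u t)) ∧
  ∀ t₀ ∈ Icc 0 T, Tendsto (fun t => sobolevNorm s (u t - u t₀)) (𝓝[Icc 0 T] t₀) (𝓝 0)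

/-! ### The scaled fluctuation problem -/

/-- `u` solves, on `[0,T] × ℝⁿ` and with initial value `f₀`,
`∂_t u + (1/ε) ∑_j V^j ∂_{x_j} u + (1/ε²) L u = (1/ε) Γ(u,u)`.
The `i`-th component of `∑_j V^j ∂_{x_j} u` is `v_i · ∇ u_i`. The equation is understood in the
sense of (tempered) distributions on `ℝⁿ`: for every test field `φ`, the function
`t ↦ ∫ ⟨u(t,x), φ(x)⟩ dx` has, at every `t ∈ [0,T]`, the derivative that the equation prescribes
after the space derivatives have been moved to `φ`. -/
structure IsWeakSolution (B : Model n m) (M : State m) (ε T : ℝ) (f₀ : L2Field n m)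
    (u : ℝ → L2Field n m) : Prop where
  initial : u 0 = f₀
  equation : ∀ φ : 𝓢(Space n, State m), ∀ t ∈ Icc 0 T,
    HasDerivWithinAt (fun s => ∫ x, inner ℝ (u s x) (φ x))
      (∫ x, (1 / ε * ∑ i, u t x i * (fderiv ℝ φ x (B.v i)) i
        - 1 / ε ^ 2 * inner ℝ (B.L M (u t x)) (φ x)
        + 1 / ε * inner ℝ (B.Γ M (u t x) (u t x)) (φ x)))
      (Icc 0 T) t

/-- `u` is a solution of the scaled fluctuation problem in the class
`L^∞([0,T], H^l) ∩ C([0,T], H^{l-1})`. -/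
structure IsSolutionInClass (B : Model n m) (M : State m) (l ε T : ℝ) (f₀ : L2Field n m)
    (u : ℝ → L2Field n m) : Prop where
  bounded : BoundedInH l T u
  continuous : ContinuousInH (l - 1) T u
  solves : IsWeakSolution B M ε T f₀ u

end DiscreteBoltzmann

end

open DiscreteBoltzmann

open MeasureTheory Set Filter Topology
open scoped ENNReal NNReal SchwartzMap FourierTransform
noncomputable section
namespace DiscreteBoltzmann
variable {n m : ℕ}

/-! The difficulty is uniformity in `ε`: the transport term is of size `1/ε`, the linear term of
size `1/ε²`, the quadratic one of size `1/ε`. Transport is harmless because it generates a group of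
isometries commuting with `(1 - Δ)^{l/2}`. The linear term controls the quadratic one by the
H-theorem: the symmetries of the rates make `L` symmetric and nonnegative, and its kernel, the
collision invariants, is orthogonal to every `Γ(f,g)`. Hence `Γ` takes values in the range of `L`,
and `Γ = L ∘ β` with `β` bilinear (`Model.exists_gamma_eq_lin_comp`). Write `f = (1 - Δ)^{-l/2} h`
with `h` in `L²`. As `l > n/2`, the space `H^l` is an algebra, so `β` lifts to a bounded bilinear
map `G` on `L²` (`exists_bilinear_lift`). With `P` the action of `L` on fields, the right-hand side
for `h` is `N(h) = -ε⁻² P h + ε⁻¹ P G(h,h)`. Completing the square in the form of `P` gives `⟨h, N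
h⟩ ≤ ¼ ⟨P G(h,h), G(h,h)⟩ ≤ C ‖h‖⁴` with `C` independent of `ε` (`inner_source_le`). Existence:
along the characteristics, `w(t) = U(-t) h(t)` solves an ordinary differential equation in a Hilbert
space with locally Lipschitz right-hand side. Its Lipschitz constant depends on `ε`, but the life
span depends only on `C` and `‖h(0)‖ = ‖f₀‖_l` (`exists_mild_solution`). Uniqueness: on bounded sets
of `H^l` the nonlinearity is Lipschitz for the `L²` norm, and a Grönwall argument on the weak
formulation (`eq_zero_of_weak_transport`) shows that the difference of two solutions vanishes. -/

/-! ### Semilinear evolution equations in a Hilbert space -/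

section Abstract

/-! ### Truncation of locally Lipschitz maps -/

section Cutoff

variable {E : Type*} [NormedAddCommGroup E]

/-- A Lipschitz cutoff: `1` on the ball of radius `R`, `0` outside the ball of radius `2R`. -/
def cutoff (R : ℝ) (x : E) : ℝ := max 0 (min 1 (2 - ‖x‖ / R))

lemma cutoff_nonneg (R : ℝ) (x : E) : 0 ≤ cutoff R x := le_max_left _ _

lemma cutoff_le_one (R : ℝ) (x : E) : cutoff R x ≤ 1 :=
  max_le zero_le_one (min_le_left _ _)

lemma cutoff_eq_one {R : ℝ} (hR : 0 < R) {x : E} (hx : ‖x‖ ≤ R) : cutoff R x = 1 := by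
  have : ‖x‖ / R ≤ 1 := (div_le_one hR).2 hx
  rw [cutoff, min_eq_left (by linarith), max_eq_right zero_le_one]

lemma cutoff_eq_zero {R : ℝ} (hR : 0 < R) {x : E} (hx : 2 * R < ‖x‖) : cutoff R x = 0 := by
  have : 2 ≤ ‖x‖ / R := (le_div_iff₀ hR).2 hx.le
  rw [cutoff, max_eq_left]
  exact (min_le_right _ _).trans (by linarith)

lemma abs_cutoff_sub_le {R : ℝ} (hR : 0 < R) (x y : E) :
    |cutoff R x - cutoff R y| ≤ ‖x - y‖ / R := by
  have h1 : |cutoff R x - cutoff R y| ≤ |(2 - ‖x‖ / R) - (2 - ‖y‖ / R)| := by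
    unfold cutoff
    rw [max_comm 0, max_comm 0]
    refine (abs_max_sub_max_le_abs _ _ _).trans ?_
    rw [min_comm 1, min_comm 1]
    exact abs_min_sub_min_le_max _ _ _ _ |>.trans (by simp)
  refine h1.trans ?_
  rw [show (2 - ‖x‖ / R) - (2 - ‖y‖ / R) = -((‖x‖ - ‖y‖) / R) by ring, abs_neg, abs_div,
    abs_of_pos hR]
  gcongr
  exact abs_norm_sub_norm_le x y

variable [NormedSpace ℝ E]

lemma norm_cutoff_smul_le {N : E → E} {R M : ℝ} (hR : 0 < R) (hM0 : 0 ≤ M)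
    (hM : ∀ x, ‖x‖ ≤ 2 * R → ‖N x‖ ≤ M) (x : E) : ‖cutoff R x • N x‖ ≤ M := by
  rw [norm_smul, Real.norm_of_nonneg (cutoff_nonneg R x)]
  by_cases hx : ‖x‖ ≤ 2 * R
  · calc _ ≤ 1 * M := by
          gcongr
          exacts [cutoff_le_one R x, hM x hx]
      _ = M := one_mul M
  · rw [cutoff_eq_zero hR (not_le.1 hx), zero_mul]
    exact hM0

/-- Split the difference as `χ(x)(N x - N y) + (χ(x) - χ(y)) N y`. By symmetry `y` may be taken in
the ball of radius `2R`; if `x` lies outside, the first summand vanishes. -/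
lemma norm_cutoff_smul_sub_le {N : E → E} {R M K : ℝ} (hR : 0 < R) (hM0 : 0 ≤ M) (hK0 : 0 ≤ K)
    (hM : ∀ x, ‖x‖ ≤ 2 * R → ‖N x‖ ≤ M)
    (hK : ∀ x y, ‖x‖ ≤ 2 * R → ‖y‖ ≤ 2 * R → ‖N x - N y‖ ≤ K * ‖x - y‖) (x y : E) :
    ‖cutoff R x • N x - cutoff R y • N y‖ ≤ (K + M / R) * ‖x - y‖ := by
  wlog hy : ‖y‖ ≤ 2 * R generalizing x y
  · by_cases hx : ‖x‖ ≤ 2 * R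
    · rw [norm_sub_rev, norm_sub_rev x]
      exact this y x hx
    · rw [cutoff_eq_zero hR (not_le.1 hx), cutoff_eq_zero hR (not_le.1 hy)]
      simp only [zero_smul, sub_self, norm_zero]
      positivity
  have h1 : ‖cutoff R x • (N x - N y)‖ ≤ K * ‖x - y‖ := by
    rw [norm_smul, Real.norm_of_nonneg (cutoff_nonneg R x)]
    by_cases hx : ‖x‖ ≤ 2 * R
    · calc _ ≤ 1 * (K * ‖x - y‖) := by
            gcongr
            exacts [cutoff_le_one R x, hK x y hx hy]
        _ = _ := one_mul _
    · rw [cutoff_eq_zero hR (not_le.1 hx), zero_mul]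
      positivity
  have h2 : ‖(cutoff R x - cutoff R y) • N y‖ ≤ ‖x - y‖ / R * M := by
    rw [norm_smul, Real.norm_eq_abs]
    gcongr
    exacts [abs_cutoff_sub_le hR x y, hM y hy]
  calc _ = ‖cutoff R x • (N x - N y) + (cutoff R x - cutoff R y) • N y‖ := by
        congr 1; module
    _ ≤ K * ‖x - y‖ + ‖x - y‖ / R * M := (norm_add_le _ _).trans (add_le_add h1 h2)
    _ = _ := by ring

end Cutoff

variable {E : Type*} [NormedAddCommGroup E] [InnerProductSpace ℝ E]

/-- `U` is a strongly continuous one-parameter group of linear isometries. -/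
structure IsIsometryGroup (U : ℝ → E →L[ℝ] E) : Prop where
  zero : ∀ x, U 0 x = x
  add : ∀ s t x, U (s + t) x = U s (U t x)
  norm_map : ∀ t x, ‖U t x‖ = ‖x‖
  continuous : ∀ x, Continuous fun t => U t x

namespace IsIsometryGroup

variable {U : ℝ → E →L[ℝ] E}

lemma apply_neg (hU : IsIsometryGroup U) (t : ℝ) (x : E) : U t (U (-t) x) = x := by
  rw [← hU.add, add_neg_cancel, hU.zero]

lemma inner_map_map (hU : IsIsometryGroup U) (t : ℝ) (x y : E) :
    inner ℝ (U t x) (U t y) = inner ℝ x y :=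
  (LinearIsometry.mk (U t).toLinearMap (hU.norm_map t)).inner_map_map x y

lemma inner_left (hU : IsIsometryGroup U) (t : ℝ) (x y : E) :
    inner ℝ (U t x) y = inner ℝ x (U (-t) y) := by
  rw [← hU.inner_map_map t x, hU.apply_neg]

lemma norm_sub_map (hU : IsIsometryGroup U) (t : ℝ) (x y : E) : ‖U t x - U t y‖ = ‖x - y‖ := by
  rw [← map_sub, hU.norm_map]

/-- Isometries are equicontinuous, so strong continuity upgrades to joint continuity in time and
vector. -/
lemma tendsto_apply (hU : IsIsometryGroup U) {ι : Type*} {F : Filter ι} {τ : ι → ℝ} {f : ι → E}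
    {t : ℝ} {x : E} (hτ : Tendsto τ F (𝓝 t)) (hf : Tendsto f F (𝓝 x)) :
    Tendsto (fun i => U (τ i) (f i)) F (𝓝 (U t x)) := by
  have h1 : Tendsto (fun i => U (τ i) (f i) - U (τ i) x) F (𝓝 0) := by
    rw [tendsto_zero_iff_norm_tendsto_zero]
    simp_rw [hU.norm_sub_map]
    exact tendsto_iff_norm_sub_tendsto_zero.1 hf
  have h2 : Tendsto (fun i => U (τ i) x) F (𝓝 (U t x)) := ((hU.continuous x).tendsto t).comp hτ
  simpa using h1.add h2

lemma continuousOn_apply (hU : IsIsometryGroup U) {s : Set ℝ} {τ : ℝ → ℝ} {f : ℝ → E}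
    (hτ : ContinuousOn τ s) (hf : ContinuousOn f s) : ContinuousOn (fun t => U (τ t) (f t)) s :=
  fun t ht => hU.tendsto_apply (hτ t ht) (hf t ht)

end IsIsometryGroup

/-- The life span of the solutions with data of norm `r`, if the energy grows at most like
`C ‖u‖⁴`. -/
def lifeSpan (C r : ℝ) : ℝ := ((|r| + 1) ^ 2 - r ^ 2) / (2 * C * (2 * (|r| + 1)) ^ 4 + 1)

lemma lifeSpan_pos {C : ℝ} (hC : 0 ≤ C) (r : ℝ) : 0 < lifeSpan C r := by
  have h : 0 < (|r| + 1) ^ 2 - r ^ 2 := by nlinarith [abs_nonneg r, sq_abs r]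
  unfold lifeSpan
  positivity

lemma lifeSpan_mul_le {C : ℝ} (hC : 0 ≤ C) (r : ℝ) :
    r ^ 2 + 2 * C * (2 * (|r| + 1)) ^ 4 * lifeSpan C r ≤ (|r| + 1) ^ 2 := by
  have h : 0 < (|r| + 1) ^ 2 - r ^ 2 := by nlinarith [abs_nonneg r, sq_abs r]
  have hD : 0 ≤ 2 * C * (2 * (|r| + 1)) ^ 4 := by positivity
  have : 2 * C * (2 * (|r| + 1)) ^ 4 * lifeSpan C r ≤ (|r| + 1) ^ 2 - r ^ 2 := by
    rw [lifeSpan, mul_div_assoc', div_le_iff₀ (by positivity)]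
    nlinarith
  linarith

/-- Existence on a time interval that depends on the nonlinearity only through the constant of
its energy estimate. -/
theorem exists_mild_solution [CompleteSpace E] {U : ℝ → E →L[ℝ] E} (hU : IsIsometryGroup U)
    {N : E → E} (hN : ∀ R : ℝ, ∃ K : ℝ, 0 ≤ K ∧
      ∀ x y, ‖x‖ ≤ R → ‖y‖ ≤ R → ‖N x - N y‖ ≤ K * ‖x - y‖)
    {C : ℝ} (hC : 0 ≤ C) (hE : ∀ x, inner ℝ x (N x) ≤ C * ‖x‖ ^ 4) (x₀ : E) :
    ∃ w : ℝ → E, w 0 = x₀ ∧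
      (∀ t ∈ Icc 0 (lifeSpan C ‖x₀‖), HasDerivWithinAt w (U (-t) (N (U t (w t))))
        (Icc 0 (lifeSpan C ‖x₀‖)) t) ∧
      ∀ t ∈ Icc 0 (lifeSpan C ‖x₀‖), ‖w t‖ ≤ ‖x₀‖ + 1 := by
  set T := lifeSpan C ‖x₀‖ with hT
  have hT0 : 0 < T := lifeSpan_pos hC _
  set R := ‖x₀‖ + 1 with hRdef
  have hR : 0 < R := by positivity
  obtain ⟨K, hK0, hK⟩ := hN (2 * R)
  set M := K * (2 * R) + ‖N 0‖ with hMdef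
  have hM0 : 0 ≤ M := by positivity
  have hM : ∀ x, ‖x‖ ≤ 2 * R → ‖N x‖ ≤ M := fun x hx => by
    have h1 := hK x 0 hx (by simpa using hR.le)
    have h2 : ‖N x‖ ≤ ‖N x - N 0‖ + ‖N 0‖ := by simpa using norm_add_le (N x - N 0) (N 0)
    rw [sub_zero] at h1
    have h3 : K * ‖x‖ ≤ K * (2 * R) := by gcongr
    linarith
  -- The truncated map is bounded and globally Lipschitz, so a solution exists on all of `[0, T]` at
  -- once, whatever `K` and `M` are.
  set G : E → E := fun x => cutoff R x • N x with hG
  have hG_apply : ∀ x, G x = cutoff R x • N x := fun _ => rfl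
  have hGlip : ∀ x y, ‖G x - G y‖ ≤ (K + M / R) * ‖x - y‖ :=
    norm_cutoff_smul_sub_le hR hM0 hK0 hM hK
  have hGM : ∀ x, ‖G x‖ ≤ M := norm_cutoff_smul_le hR hM0 hM
  have hK' : 0 ≤ K + M / R := by positivity
  have hGL : LipschitzWith ⟨K + M / R, hK'⟩ G :=
    LipschitzWith.of_dist_le_mul fun x y => by
      rw [dist_eq_norm, dist_eq_norm]; exact hGlip x y
  -- A curve of speed at most `M` stays within distance `M * T` of its starting point, which gives
  -- the radius of the ball.
  have hPL : IsPicardLindelof (fun t x => U (-t) (G (U t x))) (⟨0, le_rfl, hT0.le⟩ : Icc 0 T) x₀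
      ⟨M * T, by positivity⟩ 0 ⟨M, hM0⟩ ⟨K + M / R, hK'⟩ := by
    refine ⟨fun t _ => ?_, fun x _ => ?_, fun t _ x _ => ?_, ?_⟩
    · refine (LipschitzWith.of_dist_le_mul fun x y => ?_).lipschitzOnWith
      rw [dist_eq_norm, dist_eq_norm, hU.norm_sub_map, ← hU.norm_sub_map t x y]
      exact hGlip _ _
    · exact hU.continuousOn_apply continuousOn_id.neg
        (hGL.continuous.comp_continuousOn (hU.continuousOn_apply continuousOn_id
          continuousOn_const))
    · rw [hU.norm_map]; exact hGM _
    · change M * max (T - 0) (0 - 0) ≤ M * T - 0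
      rw [sub_zero, sub_zero, sub_zero, max_eq_left hT0.le]
  obtain ⟨w, hw0, hw⟩ := hPL.exists_eq_forall_mem_Icc_hasDerivWithinAt₀
  simp only at hw0 hw
  have hsq : ∀ t ∈ Icc 0 T, ‖w t‖ ^ 2 ≤ ‖x₀‖ ^ 2 + 2 * C * (2 * R) ^ 4 * t := by
    have hcont : ContinuousOn (fun t => ‖w t‖ ^ 2) (Icc 0 T) :=
      (HasDerivWithinAt.continuousOn hw).norm.pow 2
    intro t ht
    refine image_le_of_deriv_right_le_deriv_boundary
      (f' := fun t => 2 * inner ℝ (w t) (U (-t) (G (U t (w t)))))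
      (B := fun t => ‖x₀‖ ^ 2 + 2 * C * (2 * R) ^ 4 * t) (B' := fun _ => 2 * C * (2 * R) ^ 4)
      hcont ?_ ?_ ?_ ?_ ?_ ht
    · intro s hs
      have := ((hw s (Ico_subset_Icc_self hs)).mono_of_mem_nhdsWithin
        (Icc_mem_nhdsGE_of_mem hs)).norm_sq
      exact this
    · simp [hw0]
    · fun_prop
    · intro s _
      simpa using (((hasDerivAt_id s).const_mul (2 * C * (2 * R) ^ 4)).const_add
        (‖x₀‖ ^ 2)).hasDerivWithinAt
    · intro s _
      -- The adjoint of `U (-s)` is `U s`, so the group drops out of the energy balance. Only the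
      -- truncated `N` remains, and its support lies in the ball of radius `2R`.
      have h1 : inner ℝ (w s) (U (-s) (G (U s (w s)))) ≤ C * (2 * R) ^ 4 := by
        rw [← hU.inner_left]
        generalize U s (w s) = x
        rw [hG, inner_smul_right]
        by_cases hx : ‖x‖ ≤ 2 * R
        · calc _ ≤ cutoff R x * (C * ‖x‖ ^ 4) :=
                mul_le_mul_of_nonneg_left (hE x) (cutoff_nonneg R x)
            _ ≤ 1 * (C * (2 * R) ^ 4) := by
                gcongr
                exact cutoff_le_one R x
            _ = _ := one_mul _
        · rw [cutoff_eq_zero hR (not_le.1 hx), zero_mul]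
          positivity
      linarith
  have hbd : ∀ t ∈ Icc 0 T, ‖w t‖ ≤ R := by
    intro t ht
    have h1 := hsq t ht
    have h2 := lifeSpan_mul_le hC ‖x₀‖
    rw [abs_of_nonneg (norm_nonneg x₀), ← hT, ← hRdef] at h2
    have h3 : 2 * C * (2 * R) ^ 4 * t ≤ 2 * C * (2 * R) ^ 4 * T := by
      gcongr; exact ht.2
    exact le_of_sq_le_sq (by linarith) hR.le
  refine ⟨w, hw0, fun t ht => ?_, hbd⟩
  -- On this interval the solution stays in the ball of radius `R`, where the cutoff equals `1`, so
  -- the untruncated equation holds.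
  have := hw t ht
  rwa [hG_apply, cutoff_eq_one hR ((hU.norm_map t _).trans_le (hbd t ht)), one_smul] at this

end Abstract

/-! ### The Fourier transform of real fields and Fourier multipliers -/

/-- `ℂᵐ`. -/
abbrev CState (m : ℕ) := EuclideanSpace ℂ (Fin m)

/-- Square-integrable fields `ℝⁿ → ℂᵐ`. -/
abbrev CField (n m : ℕ) := Lp (CState m) 2 (volume : Measure (Space n))

@[simp] lemma stateToComplex_apply (x : State m) (i : Fin m) : stateToComplex m x i = (x i : ℂ) :=
  rfl

@[simp] lemma norm_stateToComplex (x : State m) : ‖stateToComplex m x‖ = ‖x‖ := by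
  simp [EuclideanSpace.norm_eq]

/-- Coordinatewise complex conjugation. -/
def conjState (m : ℕ) : CState m →L[ℝ] CState m :=
  LinearMap.toContinuousLinearMap
    { toFun := fun z => WithLp.toLp 2 fun i => starRingEnd ℂ (z i)
      map_add' := fun x y => by ext i; simp
      map_smul' := fun c x => by ext i; simp }

/-- Coordinatewise real part. -/
def reState (m : ℕ) : CState m →L[ℝ] State m :=
  LinearMap.toContinuousLinearMap
    { toFun := fun z => WithLp.toLp 2 fun i => (z i).re
      map_add' := fun x y => by ext i; simp
      map_smul' := fun c x => by ext i; simp }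

@[simp] lemma conjState_apply (z : CState m) (i : Fin m) :
    conjState m z i = starRingEnd ℂ (z i) := rfl

@[simp] lemma reState_apply (z : CState m) (i : Fin m) : reState m z i = (z i).re := rfl

@[simp] lemma conjState_stateToComplex (x : State m) :
    conjState m (stateToComplex m x) = stateToComplex m x := by
  ext i; simp

lemma stateToComplex_reState {z : CState m} (h : conjState m z = z) :
    stateToComplex m (reState m z) = z := by
  ext i
  have : starRingEnd ℂ (z i) = z i := congrArg (fun w : CState m => w i) h
  simpa using Complex.conj_eq_iff_re.1 this

lemma conjState_smul (c : ℂ) (z : CState m) :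
    conjState m (c • z) = starRingEnd ℂ c • conjState m z := by
  ext i; simp

/-- The reflection `h ↦ conj (h (-ξ))` of square-integrable fields. -/
def reflect (h : CField n m) : CField n m :=
  (conjState m).compLp (Lp.compMeasurePreserving (fun ξ : Space n => -ξ)
    (Measure.measurePreserving_neg volume) h)

lemma coeFn_reflect (h : CField n m) :
    reflect h =ᵐ[volume] fun ξ => conjState m (h (-ξ)) := by
  filter_upwards [(conjState m).coeFn_compLp (Lp.compMeasurePreserving (fun ξ : Space n => -ξ)
    (Measure.measurePreserving_neg volume) h), Lp.coeFn_compMeasurePreserving h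
    (Measure.measurePreserving_neg (volume : Measure (Space n)))] with ξ h1 h2
  rw [reflect, h1, h2]
  rfl

lemma continuous_reflect : Continuous (reflect : CField n m → CField n m) := by
  refine ((conjState m).compLpL 2 volume).continuous.comp ?_
  exact (Lp.compMeasurePreservingₗᵢ ℝ (fun ξ : Space n => -ξ)
    (Measure.measurePreserving_neg volume)).continuous

lemma fourier_conj_schwartz (φ : 𝓢(Space n, CState m)) (ξ : Space n) :
    𝓕 (φ.postcompCLM (conjState m)) ξ = conjState m (𝓕 φ (-ξ)) := by
  rw [SchwartzMap.fourier_coe, SchwartzMap.fourier_coe, Real.fourier_eq, Real.fourier_eq,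
    ← ContinuousLinearMap.integral_comp_comm]
  · congr 1 with x
    rw [SchwartzMap.postcompCLM_apply, Circle.smul_def, Circle.smul_def, conjState_smul,
      inner_neg_right, neg_neg, Real.fourierChar_apply, Real.fourierChar_apply, ← Complex.exp_conj]
    rw [map_mul, Complex.conj_I, Complex.conj_ofReal,
      show ((2 * Real.pi * inner ℝ x ξ : ℝ) : ℂ) * -Complex.I
        = ((2 * Real.pi * -inner ℝ x ξ : ℝ) : ℂ) * Complex.I by push_cast; ring]
  · exact (Real.fourierIntegral_convergent_iff _).2 φ.integrable

/-- Checked on Schwartz functions by conjugating the kernel, then extended by density, both sides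
being continuous in `L²`. -/
lemma fourier_conj (h : CField n m) : 𝓕 ((conjState m).compLp h) = reflect (𝓕 h) := by
  refine DenseRange.induction_on
    (p := fun h : CField n m => 𝓕 ((conjState m).compLp h) = reflect (𝓕 h))
    (SchwartzMap.denseRange_toLpCLM (E := Space n) (F := CState m) (p := 2)
      ENNReal.ofNat_ne_top) h ?_ ?_
  · exact isClosed_eq ((Lp.fourierTransformₗᵢ (Space n) (CState m)).continuous.comp
      ((conjState m).compLpL 2 volume).continuous)
      (continuous_reflect.comp (Lp.fourierTransformₗᵢ (Space n) (CState m)).continuous)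
  · intro φ
    have h1 : (conjState m).compLp (φ.toLp 2 volume)
        = (φ.postcompCLM (conjState m)).toLp 2 volume := by
      ext1
      filter_upwards [(conjState m).coeFn_compLp (φ.toLp 2 volume), φ.coeFn_toLp 2 volume,
        (φ.postcompCLM (conjState m)).coeFn_toLp 2 volume] with x h1 h2 h3
      rw [h1, h2, h3, SchwartzMap.postcompCLM_apply]
    rw [SchwartzMap.toLpCLM_apply, h1, SchwartzMap.toLp_fourier_eq, SchwartzMap.toLp_fourier_eq]
    ext1
    have h2 := (Measure.measurePreserving_neg
      (volume : Measure (Space n))).quasiMeasurePreserving.ae_eq_comp ((𝓕 φ).coeFn_toLp 2 volume)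
    filter_upwards [coeFn_reflect ((𝓕 φ).toLp 2 volume), h2,
      (𝓕 (φ.postcompCLM (conjState m))).coeFn_toLp 2 volume] with ξ h3 h4 h5
    rw [h3, h5, fourier_conj_schwartz]
    exact congrArg _ h4.symm

/-- `fourierL2` as a linear isometry. -/
def fourierIsometry (n m : ℕ) : L2Field n m →ₗᵢ[ℝ] CField n m where
  toFun := fourierL2
  map_add' u v := by
    change (Lp.fourierTransformₗᵢ _ _) (((stateToComplex m).compLpL 2 volume) (u + v)) = _
    rw [map_add, map_add]; rfl
  map_smul' c u := by
    change (Lp.fourierTransformₗᵢ _ _) (((stateToComplex m).compLpL 2 volume) (c • u)) = _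
    rw [map_smul, RingHom.id_apply]
    exact ((Lp.fourierTransformₗᵢ (Space n) (CState m)).toLinearEquiv.toLinearMap.restrictScalars
      ℝ).map_smul c _
  norm_map' u := by
    change ‖fourierL2 u‖ = _
    rw [fourierL2, Lp.norm_fourier_eq, Lp.norm_def, Lp.norm_def]
    congr 1
    refine eLpNorm_congr_norm_ae ?_
    filter_upwards [(stateToComplex m).coeFn_compLp u] with x hx
    rw [hx, norm_stateToComplex]

lemma fourierL2_injective : Function.Injective (fourierL2 : L2Field n m → CField n m) :=
  (fourierIsometry n m).injective

lemma norm_fourierL2 (u : L2Field n m) : ‖fourierL2 u‖ = ‖u‖ := (fourierIsometry n m).norm_map u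

lemma fourierL2_add (u v : L2Field n m) : fourierL2 (u + v) = fourierL2 u + fourierL2 v :=
  (fourierIsometry n m).map_add u v

lemma fourierL2_sub (u v : L2Field n m) : fourierL2 (u - v) = fourierL2 u - fourierL2 v :=
  (fourierIsometry n m).map_sub u v

lemma fourierL2_smul (c : ℝ) (u : L2Field n m) : fourierL2 (c • u) = c • fourierL2 u :=
  (fourierIsometry n m).map_smul c u

lemma conj_compLp_stateToComplex (u : L2Field n m) :
    (conjState m).compLp ((stateToComplex m).compLp u) = (stateToComplex m).compLp u := by
  ext1
  filter_upwards [(conjState m).coeFn_compLp ((stateToComplex m).compLp u),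
    (stateToComplex m).coeFn_compLp u] with x h1 h2
  rw [h1, h2, conjState_stateToComplex]

lemma reflect_fourierL2 (u : L2Field n m) : reflect (fourierL2 u) = fourierL2 u := by
  rw [fourierL2, ← fourier_conj, conj_compLp_stateToComplex]

lemma ae_fourierL2_neg (u : L2Field n m) :
    ∀ᵐ ξ, conjState m (fourierL2 u (-ξ)) = fourierL2 u ξ := by
  filter_upwards [coeFn_reflect (fourierL2 u)] with ξ h
  rw [← h, reflect_fourierL2]

/-- The fields with the symmetry of the Fourier transform of a real field are such transforms. -/
lemma exists_fourierL2_eq {h : CField n m} (hs : ∀ᵐ ξ, conjState m (h (-ξ)) = h ξ) :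
    ∃ u : L2Field n m, fourierL2 u = h := by
  have hr : reflect h = h := by
    ext1
    filter_upwards [coeFn_reflect h, hs] with ξ h1 h2
    rw [h1, h2]
  set g : CField n m := 𝓕⁻ h with hg
  -- The symmetry of `h` says exactly that its inverse transform is fixed by conjugation, that is,
  -- real.
  have hgc : (conjState m).compLp g = g := by
    apply (Lp.fourierTransformₗᵢ (Space n) (CState m)).injective
    change 𝓕 ((conjState m).compLp g) = 𝓕 g
    rw [fourier_conj, hg, FourierTransform.fourier_fourierInv_eq, hr]
  refine ⟨(reState m).compLp g, ?_⟩
  have : (stateToComplex m).compLp ((reState m).compLp g) = g := by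
    ext1
    have h0 : ∀ᵐ x, conjState m (g x) = g x := by
      filter_upwards [(conjState m).coeFn_compLp g] with x h1
      rw [← h1, hgc]
    filter_upwards [(stateToComplex m).coeFn_compLp ((reState m).compLp g),
      (reState m).coeFn_compLp g, h0] with x h1 h2 h3
    rw [h1, h2, stateToComplex_reState h3]
  rw [fourierL2, this, hg, FourierTransform.fourier_fourierInv_eq]

/-! ### Diagonal Fourier multipliers -/

/-- Coordinatewise multiplication. -/
def diag (a : Fin m → ℂ) (z : CState m) : CState m := WithLp.toLp 2 fun i => a i * z i

@[simp] lemma diag_apply (a : Fin m → ℂ) (z : CState m) (i : Fin m) : diag a z i = a i * z i := rfl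

lemma norm_diag_le {a : Fin m → ℂ} {K : ℝ} (hK : 0 ≤ K) (ha : ∀ i, ‖a i‖ ≤ K) (z : CState m) :
    ‖diag a z‖ ≤ K * ‖z‖ := by
  rw [EuclideanSpace.norm_eq, EuclideanSpace.norm_eq, ← Real.sqrt_sq hK,
    ← Real.sqrt_mul (sq_nonneg K), Finset.mul_sum]
  refine Real.sqrt_le_sqrt (Finset.sum_le_sum fun i _ => ?_)
  rw [diag_apply, norm_mul, mul_pow]
  gcongr
  exact ha i

lemma conjState_diag (a : Fin m → ℂ) (z : CState m) :
    conjState m (diag a z) = diag (fun i => starRingEnd ℂ (a i)) (conjState m z) := by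
  ext i; simp

lemma aestronglyMeasurable_diag {a : Space n → Fin m → ℂ} (ha : ∀ i, Measurable fun ξ => a ξ i)
    {h : Space n → CState m} (hh : AEStronglyMeasurable h) :
    AEStronglyMeasurable fun ξ => diag (a ξ) (h ξ) := by
  refine (PiLp.continuous_toLp 2 _).comp_aestronglyMeasurable ?_
  refine (aemeasurable_pi_iff.2 fun i => ?_).aestronglyMeasurable
  refine AEStronglyMeasurable.aemeasurable ?_
  exact (ha i).aestronglyMeasurable.mul
    ((EuclideanSpace.proj (𝕜 := ℂ) i).continuous.comp_aestronglyMeasurable hh)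

/-- The symbols of bounded diagonal Fourier multipliers that preserve real fields. -/
structure IsSymbol (a : Space n → Fin m → ℂ) (K : ℝ) : Prop where
  measurable : ∀ i, Measurable fun ξ => a ξ i
  bound : ∀ ξ i, ‖a ξ i‖ ≤ K
  symm : ∀ ξ i, a (-ξ) i = starRingEnd ℂ (a ξ i)
  nonneg : 0 ≤ K

/-- The symbol need not be bounded: with the growing weight this inverts the Bessel potential on
`H^l`. -/
lemma exists_fourierL2_eq_diag {a : Space n → Fin m → ℂ} (ha : ∀ i, Measurable fun ξ => a ξ i)
    (hs : ∀ ξ i, a (-ξ) i = starRingEnd ℂ (a ξ i)) (u : L2Field n m)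
    (hu : eLpNorm (fun ξ => diag (a ξ) (fourierL2 u ξ)) 2 volume < ∞) :
    ∃ v : L2Field n m, fourierL2 v =ᵐ[volume] fun ξ => diag (a ξ) (fourierL2 u ξ) := by
  have hmem : MemLp (fun ξ => diag (a ξ) (fourierL2 u ξ)) 2 volume :=
    ⟨aestronglyMeasurable_diag ha (Lp.aestronglyMeasurable _), hu⟩
  obtain ⟨v, hv⟩ := exists_fourierL2_eq (h := hmem.toLp _) (by
    have h2 := (Measure.measurePreserving_neg
      (volume : Measure (Space n))).quasiMeasurePreserving.ae_eq_comp hmem.coeFn_toLp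
    filter_upwards [hmem.coeFn_toLp, h2, ae_fourierL2_neg u] with ξ h1 h2 h3
    rw [h1]
    simp only [Function.comp] at h2
    rw [h2, conjState_diag, h3]
    congr 1
    ext i
    rw [hs, Complex.conj_conj])
  exact ⟨v, hv ▸ hmem.coeFn_toLp⟩

namespace IsSymbol

variable {a : Space n → Fin m → ℂ} {K : ℝ}

/-- The values are chosen one field at a time; linearity follows from injectivity of the Fourier
transform. -/
lemma exists_multiplier (ha : IsSymbol a K) : ∃ T : L2Field n m →L[ℝ] L2Field n m,
    (∀ u, fourierL2 (T u) =ᵐ[volume] fun ξ => diag (a ξ) (fourierL2 u ξ)) ∧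
      ∀ u, ‖T u‖ ≤ K * ‖u‖ := by
  have hle : ∀ u : L2Field n m, ∀ ξ, ‖diag (a ξ) (fourierL2 u ξ)‖ ≤ K * ‖fourierL2 u ξ‖ :=
    fun u ξ => norm_diag_le ha.nonneg (ha.bound ξ) _
  have hex : ∀ u : L2Field n m, ∃ v : L2Field n m,
      fourierL2 v =ᵐ[volume] fun ξ => diag (a ξ) (fourierL2 u ξ) := fun u =>
    exists_fourierL2_eq_diag ha.measurable ha.symm u
      ((MemLp.of_le_mul (Lp.memLp (fourierL2 u))
        (aestronglyMeasurable_diag ha.measurable (Lp.aestronglyMeasurable _))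
        (Eventually.of_forall (hle u))).2)
  choose T hT using hex
  have hnorm : ∀ u, ‖T u‖ ≤ K * ‖u‖ := fun u => by
    rw [← norm_fourierL2, ← norm_fourierL2 u]
    refine Lp.norm_le_mul_norm_of_ae_le_mul ?_
    filter_upwards [hT u] with ξ h
    rw [h]
    exact hle u ξ
  let L : L2Field n m →ₗ[ℝ] L2Field n m :=
    { toFun := T
      map_add' := fun u v => by
        apply fourierL2_injective
        ext1
        rw [fourierL2_add]
        have h := hT (u + v)
        rw [fourierL2_add] at h
        filter_upwards [h, hT u, hT v, Lp.coeFn_add (fourierL2 (T u)) (fourierL2 (T v)),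
          Lp.coeFn_add (fourierL2 u) (fourierL2 v)] with ξ h1 h2 h3 h4 h5
        rw [h1, h4, Pi.add_apply, h2, h3, h5]
        ext i
        simp [mul_add]
      map_smul' := fun c u => by
        apply fourierL2_injective
        ext1
        rw [fourierL2_smul]
        have h := hT (c • u)
        rw [fourierL2_smul] at h
        filter_upwards [h, hT u, Lp.coeFn_smul c (fourierL2 (T u)),
          Lp.coeFn_smul c (fourierL2 u)] with ξ h1 h2 h3 h4
        rw [h1, RingHom.id_apply, h3, Pi.smul_apply, h2, h4]
        ext i
        simp [mul_left_comm] }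
  exact ⟨L.mkContinuous K hnorm, hT, hnorm⟩

/-- The Fourier multiplier with a given symbol. -/
def multiplier (ha : IsSymbol a K) : L2Field n m →L[ℝ] L2Field n m := ha.exists_multiplier.choose

lemma fourierL2_multiplier (ha : IsSymbol a K) (u : L2Field n m) :
    fourierL2 (ha.multiplier u) =ᵐ[volume] fun ξ => diag (a ξ) (fourierL2 u ξ) :=
  ha.exists_multiplier.choose_spec.1 u

lemma multiplier_comm (ha : IsSymbol a K) {b : Space n → Fin m → ℂ} {K' : ℝ}
    (hb : IsSymbol b K') (u : L2Field n m) :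
    ha.multiplier (hb.multiplier u) = hb.multiplier (ha.multiplier u) := by
  apply fourierL2_injective
  ext1
  filter_upwards [ha.fourierL2_multiplier (hb.multiplier u),
    hb.fourierL2_multiplier (ha.multiplier u), ha.fourierL2_multiplier u,
    hb.fourierL2_multiplier u] with ξ h1 h2 h3 h4
  rw [h1, h2, h3, h4]
  ext i
  simp [mul_left_comm]

end IsSymbol

/-! ### Bessel potentials -/

/-- The weight `(1 + |2πξ|²)^{s/2}` of the Sobolev norm. -/
def weight (s : ℝ) (ξ : Space n) : ℝ := (1 + ‖(2 * Real.pi) • ξ‖ ^ 2) ^ (s / 2)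

lemma one_le_weight_base (ξ : Space n) : 1 ≤ 1 + ‖(2 * Real.pi) • ξ‖ ^ 2 := by
  have := sq_nonneg ‖(2 * Real.pi) • ξ‖
  linarith

lemma weight_pos (s : ℝ) (ξ : Space n) : 0 < weight s ξ :=
  Real.rpow_pos_of_pos (zero_lt_one.trans_le (one_le_weight_base ξ)) _

lemma weight_mono {s t : ℝ} (h : s ≤ t) (ξ : Space n) : weight s ξ ≤ weight t ξ :=
  Real.rpow_le_rpow_of_exponent_le (one_le_weight_base ξ) (by linarith)

lemma weight_zero (ξ : Space n) : weight 0 ξ = 1 := by simp [weight]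

lemma weight_mul_weight_neg (s : ℝ) (ξ : Space n) : weight s ξ * weight (-s) ξ = 1 := by
  rw [weight, weight, ← Real.rpow_add (zero_lt_one.trans_le (one_le_weight_base ξ))]
  simp [neg_div]

lemma weight_neg_arg (s : ℝ) (ξ : Space n) : weight s (-ξ) = weight s ξ := by
  simp [weight]

lemma continuous_weight (s : ℝ) : Continuous (weight s : Space n → ℝ) := by
  refine Continuous.rpow_const (by fun_prop) fun ξ => Or.inl ?_
  exact (zero_lt_one.trans_le (one_le_weight_base ξ)).ne'

lemma sobolevNorm_eq (s : ℝ) (u : L2Field n m) :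
    sobolevNorm s u = eLpNorm (fun ξ => weight s ξ • fourierL2 u ξ) 2 volume := rfl

lemma sobolevNorm_mono {s t : ℝ} (h : s ≤ t) (u : L2Field n m) :
    sobolevNorm s u ≤ sobolevNorm t u := by
  rw [sobolevNorm_eq, sobolevNorm_eq]
  refine eLpNorm_mono fun ξ => ?_
  rw [norm_smul, norm_smul, Real.norm_of_nonneg (weight_pos s ξ).le,
    Real.norm_of_nonneg (weight_pos t ξ).le]
  gcongr
  exact weight_mono h ξ

lemma isSymbol_weight {l : ℝ} (hl : 0 ≤ l) :
    IsSymbol (fun (ξ : Space n) (_ : Fin m) => (weight (-l) ξ : ℂ)) 1 where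
  measurable _ := (Complex.continuous_ofReal.comp (continuous_weight _)).measurable
  bound ξ _ := by
    rw [Complex.norm_real, Real.norm_of_nonneg (weight_pos _ _).le]
    exact (weight_mono (by linarith) ξ).trans_eq (weight_zero ξ)
  symm ξ _ := by rw [weight_neg_arg, Complex.conj_ofReal]
  nonneg := zero_le_one

lemma diag_ofReal (c : ℝ) (z : CState m) : diag (fun _ => (c : ℂ)) z = c • z := by
  ext i; simp

/-- The Bessel potential `(1 - Δ)^{-l/2}` on real fields, an isometry of `L²` onto `H^l`. -/
def bessel {l : ℝ} (hl : 0 ≤ l) : L2Field n m →L[ℝ] L2Field n m := (isSymbol_weight hl).multiplier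

section Bessel

variable {l : ℝ} (hl : 0 ≤ l)

include hl

lemma fourierL2_bessel (h : L2Field n m) :
    fourierL2 (bessel hl h) =ᵐ[volume] fun ξ => weight (-l) ξ • fourierL2 h ξ := by
  filter_upwards [(isSymbol_weight hl).fourierL2_multiplier h] with ξ h1
  rw [bessel, h1, diag_ofReal]

lemma sobolevNorm_bessel (h : L2Field n m) : sobolevNorm l (bessel hl h) = ‖h‖ₑ := by
  rw [sobolevNorm_eq, ← ofReal_norm, ← norm_fourierL2, Lp.norm_def,
    ENNReal.ofReal_toReal (Lp.eLpNorm_ne_top _)]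
  refine eLpNorm_congr_ae ?_
  filter_upwards [fourierL2_bessel hl h] with ξ h1
  rw [h1, smul_smul, weight_mul_weight_neg, one_smul]

lemma bessel_injective : Function.Injective (bessel hl : L2Field n m →L[ℝ] L2Field n m) := by
  refine (injective_iff_map_eq_zero _).2 fun h h0 => ?_
  have h1 := sobolevNorm_bessel hl h
  have h2 := sobolevNorm_bessel hl (0 : L2Field n m)
  rw [map_zero, enorm_zero] at h2
  rw [h0, h2] at h1
  exact enorm_eq_zero.1 h1.symm

lemma norm_bessel_le (h : L2Field n m) : ‖bessel hl h‖ ≤ ‖h‖ := by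
  rw [← norm_fourierL2, ← norm_fourierL2 h]
  refine Lp.norm_le_norm_of_ae_le ?_
  filter_upwards [fourierL2_bessel hl h] with ξ h1
  rw [h1, norm_smul, Real.norm_of_nonneg (weight_pos _ _).le]
  have := (weight_mono (show -l ≤ 0 by linarith) ξ).trans_eq (weight_zero ξ)
  nlinarith [norm_nonneg (fourierL2 h ξ)]

lemma exists_bessel_eq {u : L2Field n m} (hu : MemH l u) : ∃ h, bessel hl h = u := by
  obtain ⟨h, hh⟩ := exists_fourierL2_eq_diag (a := fun ξ _ => (weight l ξ : ℂ))
    (fun _ => (Complex.continuous_ofReal.comp (continuous_weight _)).measurable)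
    (fun ξ _ => by rw [weight_neg_arg, Complex.conj_ofReal]) u (by
      simp_rw [diag_ofReal]
      exact hu)
  refine ⟨h, fourierL2_injective ?_⟩
  ext1
  filter_upwards [fourierL2_bessel hl h, hh] with ξ h1 h2
  rw [h1, h2, diag_ofReal, smul_smul, mul_comm, weight_mul_weight_neg, one_smul]

end Bessel

/-! ### The Fourier transform of integrable functions -/

/-- The `L²` inverse transform is defined by extension, the other one by an integral. Paired with a
test function, each moves the inverse transform onto that function, so they agree as distributions,
hence almost everywhere. -/
lemma ae_fourierInv_eq {g : CField n m} (hg : Integrable g) :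
    (𝓕⁻ g : CField n m) =ᵐ[volume] 𝓕⁻ (g : Space n → CState m) := by
  have hcont : Continuous (𝓕⁻ (g : Space n → CState m)) := by
    have : 𝓕⁻ (g : Space n → CState m) = fun x => 𝓕 (g : Space n → CState m) (-x) := by
      ext1 x; rw [Real.fourierInv_eq_fourier_neg]
    rw [this]
    exact (VectorFourier.fourierIntegral_continuous Real.continuous_fourierChar
      (innerSL ℝ).continuous₂ hg).comp continuous_neg
  refine ae_eq_of_integral_contDiff_smul_eq
    ((Lp.memLp (𝓕⁻ g : CField n m)).locallyIntegrable one_le_two) hcont.locallyIntegrable ?_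
  intro φ hφ hφc
  have hc1 : HasCompactSupport (Complex.ofRealCLM ∘ φ) := hφc.comp_left rfl
  have hc2 : ContDiff ℝ (⊤ : ℕ∞) (Complex.ofRealCLM ∘ φ) := Complex.ofRealCLM.contDiff.comp hφ
  set ψ : 𝓢(Space n, ℂ) := hc1.toSchwartzMap hc2
  have hψ : ∀ x, ψ x = (φ x : ℂ) := fun x => rfl
  have h1 := DFunLike.congr_fun (Lp.fourierInv_toTemperedDistribution_eq g) ψ
  rw [TemperedDistribution.fourierInv_apply, Lp.toTemperedDistribution_apply,
    Lp.toTemperedDistribution_apply] at h1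
  have h2 : ∫ x, (𝓕⁻ ψ) x • g x = ∫ x, ψ x • (𝓕⁻ (g : Space n → CState m)) x := by
    -- The negated inner product turns the general Fourier integral into the inverse transform.
    have := VectorFourier.integral_fourierIntegral_smul_eq_flip (𝕜 := ℝ) (μ := volume)
      (ν := volume) (L := -(innerₗ (Space n))) (e := Real.fourierChar) (f := ψ) (g := g)
      Real.continuous_fourierChar
      (show Continuous fun p : Space n × Space n => -inner ℝ p.1 p.2 by fun_prop) ψ.integrable hg
    rw [SchwartzMap.fourierInv_coe]
    simp only [VectorFourier.fourierIntegral, LinearMap.neg_apply, innerₗ_apply_apply, neg_neg,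
      LinearMap.flip_apply] at this
    simp only [Real.fourierInv_eq, this]
    simp only [real_inner_comm]
  simp only [hψ] at h1 h2
  calc ∫ x, φ x • (𝓕⁻ g : CField n m) x = ∫ x, (φ x : ℂ) • (𝓕⁻ g : CField n m) x := by
        congr 1
    _ = ∫ x, (φ x : ℂ) • (𝓕⁻ (g : Space n → CState m)) x := by rw [← h1, h2]
    _ = _ := by congr 1

/-! ### Products in Sobolev spaces of high order -/

lemma lintegral_mul_sq_le {X : Type*} [MeasurableSpace X] {μ : Measure X} {f g : X → ℝ≥0∞}
    (hf : AEMeasurable f μ) (hg : AEMeasurable g μ) :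
    (∫⁻ x, f x * g x ∂μ) ^ 2 ≤ (∫⁻ x, f x ^ 2 ∂μ) * ∫⁻ x, g x ^ 2 ∂μ := by
  have h := ENNReal.lintegral_mul_le_Lp_mul_Lq μ Real.HolderConjugate.two_two hf hg
  simp only [Pi.mul_apply, ENNReal.rpow_two] at h
  refine (pow_le_pow_left' h 2).trans_eq ?_
  rw [mul_pow, ← ENNReal.rpow_natCast, ← ENNReal.rpow_natCast, ← ENNReal.rpow_mul,
    ← ENNReal.rpow_mul]
  norm_num

lemma eLpNorm_two_sq {X F : Type*} [MeasurableSpace X] {μ : Measure X} [NormedAddCommGroup F]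
    (f : X → F) : eLpNorm f 2 μ ^ 2 = ∫⁻ x, ‖f x‖ₑ ^ 2 ∂μ := by
  have := eLpNorm_nnreal_pow_eq_lintegral (f := f) (μ := μ) (p := 2) two_ne_zero
  simpa using this

lemma lintegral_enorm_fourierL2_sq (h : L2Field n m) :
    ∫⁻ ξ, ‖fourierL2 h ξ‖ₑ ^ 2 = ‖h‖ₑ ^ 2 := by
  rw [← eLpNorm_two_sq, ← ofReal_norm, ← norm_fourierL2, Lp.norm_def,
    ENNReal.ofReal_toReal (Lp.eLpNorm_ne_top _)]

/-- The decaying weight `(1 + |2πξ|²)^{-l/2}` as a function with values in `[0, ∞]`. -/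
def decay (l : ℝ) (ξ : Space n) : ℝ≥0∞ := ENNReal.ofReal (weight (-l) ξ)

lemma measurable_decay (l : ℝ) : Measurable (decay l : Space n → ℝ≥0∞) :=
  (continuous_weight _).measurable.ennreal_ofReal

/-- This is where `l > n/2` enters: the decaying weight is square integrable, which gives both the
embedding in `L^∞` and the product estimate. As `(2π)² ≥ 1`, the factor `2π` may be dropped. -/
lemma lintegral_decay_sq_lt_top {l : ℝ} (hl : (n : ℝ) / 2 < l) :
    ∫⁻ ξ : Space n, decay l ξ ^ 2 < ∞ := by
  have hint : Integrable (fun ξ : Space n => (1 + ‖ξ‖ ^ 2) ^ (-(2 * l) / 2)) :=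
    integrable_rpow_neg_one_add_norm_sq (by simpa using by linarith)
  refine lt_of_le_of_lt (lintegral_mono fun ξ => ?_) hint.lintegral_lt_top
  rw [decay, ← ENNReal.ofReal_pow (weight_pos _ _).le]
  refine ENNReal.ofReal_le_ofReal ?_
  have hl0 : 0 ≤ l := le_trans (by positivity) hl.le
  rw [weight, ← Real.rpow_mul_natCast (zero_le_one.trans (one_le_weight_base ξ)),
    show -l / 2 * ((2 : ℕ) : ℝ) = -(2 * l) / 2 by push_cast; ring]
  refine Real.rpow_le_rpow_of_nonpos (by positivity) ?_ (by linarith)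
  rw [norm_smul, mul_pow, Real.norm_of_nonneg Real.two_pi_pos.le]
  have : 1 ≤ (2 * Real.pi) ^ 2 := one_le_pow₀ (by linarith [Real.pi_gt_three])
  nlinarith [sq_nonneg ‖ξ‖]

/-- If `|η| ≤ |ξ|`, then `|ξ + η| ≤ 2|ξ|`, so the base of the power grows at most by `4`, and
`4^{l/2} = 2^l`. -/
lemma weight_add_le {l : ℝ} (hl : 0 ≤ l) (ξ η : Space n) :
    weight l (ξ + η) ≤ 2 ^ l * (weight l ξ + weight l η) := by
  wlog h : ‖(2 * Real.pi) • η‖ ≤ ‖(2 * Real.pi) • ξ‖ generalizing ξ η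
  · rw [add_comm ξ, add_comm (weight l ξ)]
    exact this η ξ (le_of_not_ge h)
  have h1 : weight l (ξ + η) ≤ 2 ^ l * weight l ξ := by
    have h2 : (2 : ℝ) ^ l = 4 ^ (l / 2) := by
      rw [show (4 : ℝ) = 2 ^ (2 : ℝ) by norm_num, ← Real.rpow_mul (by norm_num)]
      congr 1; ring
    rw [weight, weight, h2, ← Real.mul_rpow (by norm_num) (by positivity)]
    refine Real.rpow_le_rpow (by positivity) ?_ (by linarith)
    have h3 : ‖(2 * Real.pi) • (ξ + η)‖ ≤ 2 * ‖(2 * Real.pi) • ξ‖ := by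
      rw [smul_add]
      exact (norm_add_le _ _).trans (by linarith)
    nlinarith [norm_nonneg ((2 * Real.pi) • (ξ + η)), norm_nonneg ((2 * Real.pi) • ξ)]
  refine h1.trans ?_
  gcongr
  linarith [weight_pos l η]

/-- The weight at `ξ = η + (ξ - η)` is absorbed by one of the two decaying factors; the other is
left over for Cauchy–Schwarz. -/
lemma weight_mul_decay_mul_decay_le {l : ℝ} (hl : 0 ≤ l) (ξ η : Space n) :
    ENNReal.ofReal (weight l ξ) * (decay l η * decay l (ξ - η)) ≤
      ENNReal.ofReal (2 ^ l) * (decay l η + decay l (ξ - η)) := by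
  rw [decay, decay, ← ENNReal.ofReal_mul (weight_pos _ _).le,
    ← ENNReal.ofReal_mul (weight_pos _ _).le, ← ENNReal.ofReal_add (weight_pos _ _).le
    (weight_pos _ _).le, ← ENNReal.ofReal_mul (by positivity)]
  refine ENNReal.ofReal_le_ofReal ?_
  have h1 := weight_add_le hl η (ξ - η)
  rw [add_sub_cancel] at h1
  have h2 := weight_mul_weight_neg l η
  have h3 := weight_mul_weight_neg l (ξ - η)
  have h4 := weight_pos (-l) η
  have h5 := weight_pos (-l) (ξ - η)
  calc weight l ξ * (weight (-l) η * weight (-l) (ξ - η))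
      ≤ 2 ^ l * (weight l η + weight l (ξ - η)) * (weight (-l) η * weight (-l) (ξ - η)) := by
        gcongr
    _ = 2 ^ l * (weight l η * weight (-l) η * weight (-l) (ξ - η)
        + weight l (ξ - η) * weight (-l) (ξ - η) * weight (-l) η) := by ring
    _ = _ := by rw [h2, h3]; ring

lemma lintegral_const_mul_lintegral_mul_sub {f g : Space n → ℝ≥0∞} (hf : Measurable f)
    (hg : Measurable g) (c : ℝ≥0∞) :
    ∫⁻ ξ, c * ∫⁻ η, f η * g (ξ - η) = c * ((∫⁻ η, f η) * ∫⁻ η, g η) := by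
  have hm : Measurable fun p : Space n × Space n => f p.2 * g (p.1 - p.2) := by fun_prop
  rw [lintegral_const_mul c hm.lintegral_prod_right', lintegral_lintegral_swap hm.aemeasurable,
    ← lintegral_mul_const _ hf]
  congr 2 with η
  change ∫⁻ ξ, f η * g (ξ - η) = _
  rw [lintegral_const_mul _ (by fun_prop), lintegral_sub_right_eq_self g η]

section Product

variable {l : ℝ} (hl : 0 ≤ l)

lemma enorm_fourierL2_bessel (h : L2Field n m) :
    ∀ᵐ ξ, ‖fourierL2 (bessel hl h) ξ‖ₑ = decay l ξ * ‖fourierL2 h ξ‖ₑ := by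
  filter_upwards [fourierL2_bessel hl h] with ξ h1
  rw [h1, enorm_smul, decay, Real.enorm_of_nonneg (weight_pos _ _).le]

lemma measurable_enorm_fourierL2 (h : L2Field n m) : Measurable fun ξ => ‖fourierL2 h ξ‖ₑ :=
  (Lp.stronglyMeasurable _).enorm

lemma lintegral_enorm_fourierL2_bessel_le (h : L2Field n m) :
    (∫⁻ ξ, ‖fourierL2 (bessel hl h) ξ‖ₑ) ^ 2 ≤
      (∫⁻ ξ : Space n, decay l ξ ^ 2) * ‖h‖ₑ ^ 2 := by
  rw [lintegral_congr_ae (enorm_fourierL2_bessel hl h), ← lintegral_enorm_fourierL2_sq]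
  exact lintegral_mul_sq_le (measurable_decay l).aemeasurable
    (measurable_enorm_fourierL2 h).aemeasurable

lemma integrable_fourierL2_bessel (hln : (n : ℝ) / 2 < l) (h : L2Field n m) :
    Integrable (fourierL2 (bessel hl h)) := by
  refine ⟨Lp.aestronglyMeasurable _, ?_⟩
  have h1 := (lintegral_enorm_fourierL2_bessel_le hl h).trans_lt
    (ENNReal.mul_lt_top (lintegral_decay_sq_lt_top hln) (by simp))
  exact (ENNReal.pow_lt_top_iff.1 h1).elim id fun h => absurd h two_ne_zero

/-- A real field whose Fourier transform is integrable is given by the inversion formula. -/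
lemma ae_eq_fourierInv_fourierL2 {u : L2Field n m} (hu : Integrable (fourierL2 u)) :
    ∀ᵐ x, stateToComplex m (u x) = 𝓕⁻ (fourierL2 u : Space n → CState m) x := by
  have h1 := ae_fourierInv_eq hu
  have h2 : (𝓕⁻ (fourierL2 u) : CField n m) = (stateToComplex m).compLp u := by
    rw [fourierL2, FourierTransform.fourierInv_fourier_eq]
  rw [h2] at h1
  filter_upwards [h1, (stateToComplex m).coeFn_compLp u] with x h3 h4
  rw [← h3, h4]

/-- The Sobolev embedding `H^l ⊂ L^∞`. -/
lemma exists_ae_norm_bessel_le (hln : (n : ℝ) / 2 < l) :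
    ∃ C : ℝ, 0 ≤ C ∧ ∀ h : L2Field n m, ∀ᵐ x, ‖bessel hl h x‖ ≤ C * ‖h‖ := by
  have hP := lintegral_decay_sq_lt_top hln
  -- The supremum is at most the `L¹` norm of the transform, and Cauchy–Schwarz bounds this by the
  -- `L²` norm of the decaying weight times `‖h‖`.
  refine ⟨√(∫⁻ ξ : Space n, decay l ξ ^ 2).toReal, Real.sqrt_nonneg _, fun h => ?_⟩
  have hi := integrable_fourierL2_bessel hl hln h
  filter_upwards [ae_eq_fourierInv_fourierL2 hi] with x hx
  rw [← norm_stateToComplex, hx, Real.fourierInv_eq]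
  refine (norm_integral_le_integral_norm _).trans ?_
  simp only [Circle.norm_smul]
  rw [integral_norm_eq_lintegral_enorm (Lp.aestronglyMeasurable _)]
  have h1 := lintegral_enorm_fourierL2_bessel_le hl h
  have h2 := ENNReal.toReal_mono (ENNReal.mul_lt_top hP (by simp)).ne h1
  rw [ENNReal.toReal_pow, ENNReal.toReal_mul, ENNReal.toReal_pow, toReal_enorm] at h2
  rw [← Real.sqrt_sq (norm_nonneg h), ← Real.sqrt_mul ENNReal.toReal_nonneg]
  exact Real.le_sqrt_of_sq_le h2

-- After the weight is distributed, Cauchy–Schwarz in `η` separates the decaying weights, whose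
-- square integral is bounded uniformly in `ξ`. What remains is the convolution of `|ĥ|²` and
-- `|k̂|²`, whose integral over `ξ` is a product.
open Convolution in
lemma enorm_weight_smul_convolution_sq_le (B : CState m →L[ℂ] CState m →L[ℂ] CState m)
    (h k : L2Field n m) (ξ : Space n) :
    ‖weight l ξ • ((fourierL2 (bessel hl h) : Space n → CState m) ⋆[B]
        (fourierL2 (bessel hl k) : Space n → CState m)) ξ‖ₑ ^ 2 ≤
      (ENNReal.ofReal (2 ^ l) * ‖B‖ₑ) ^ 2 * (4 * ∫⁻ ξ : Space n, decay l ξ ^ 2) *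
        ∫⁻ η, ‖fourierL2 h η‖ₑ ^ 2 * ‖fourierL2 k (ξ - η)‖ₑ ^ 2 := by
  set P := ∫⁻ ξ : Space n, decay l ξ ^ 2 with hP
  set C := ENNReal.ofReal (2 ^ l) * ‖B‖ₑ with hC
  have mH := measurable_enorm_fourierL2 h
  have mK := measurable_enorm_fourierL2 k
  have md := measurable_decay (n := n) l
  set H : Space n → ℝ≥0∞ := fun ξ => ‖fourierL2 h ξ‖ₑ with hH
  set K : Space n → ℝ≥0∞ := fun ξ => ‖fourierL2 k ξ‖ₑ with hK
  have hk' : ∀ᵐ η, ‖fourierL2 (bessel hl k) (ξ - η)‖ₑ = decay l (ξ - η) * K (ξ - η) :=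
    (quasiMeasurePreserving_sub_left volume ξ).ae (enorm_fourierL2_bessel hl k)
  have h1 : ‖weight l ξ • ((fourierL2 (bessel hl h) : Space n → CState m) ⋆[B]
      (fourierL2 (bessel hl k) : Space n → CState m)) ξ‖ₑ ≤
      C * ∫⁻ η, (decay l η + decay l (ξ - η)) * (H η * K (ξ - η)) := by
    rw [enorm_smul, Real.enorm_of_nonneg (weight_pos _ _).le, convolution_def,
      ← lintegral_const_mul _ (by fun_prop)]
    calc _ ≤ ENNReal.ofReal (weight l ξ) * ∫⁻ η, ‖B (fourierL2 (bessel hl h) η)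
            (fourierL2 (bessel hl k) (ξ - η))‖ₑ := by
          gcongr
          exact enorm_integral_le_lintegral_enorm _
      _ ≤ ENNReal.ofReal (weight l ξ) * ∫⁻ η, ‖B‖ₑ * (decay l η * H η) *
            (decay l (ξ - η) * K (ξ - η)) := by
          refine mul_le_mul_right (lintegral_mono_ae ?_) _
          filter_upwards [enorm_fourierL2_bessel hl h, hk'] with η h2 h3
          rw [← h3, hH, ← h2]
          refine (ContinuousLinearMap.le_opENorm _ _).trans ?_
          gcongr
          exact ContinuousLinearMap.le_opENorm _ _
      _ = ∫⁻ η, ENNReal.ofReal (weight l ξ) * (‖B‖ₑ * (decay l η * H η) *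
            (decay l (ξ - η) * K (ξ - η))) := by
          rw [lintegral_const_mul _ (by fun_prop)]
      _ ≤ _ := by
          refine lintegral_mono fun η => ?_
          calc _ = ENNReal.ofReal (weight l ξ) * (decay l η * decay l (ξ - η)) *
                (‖B‖ₑ * (H η * K (ξ - η))) := by ring
            _ ≤ ENNReal.ofReal (2 ^ l) * (decay l η + decay l (ξ - η)) *
                (‖B‖ₑ * (H η * K (ξ - η))) := by
              gcongr ?_ * _
              exact weight_mul_decay_mul_decay_le hl ξ η
            _ = _ := by rw [hC]; ring
  have h2 : ∫⁻ η, (decay l η + decay l (ξ - η)) ^ 2 ≤ 4 * P := by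
    calc _ ≤ ∫⁻ η, (2 * decay l η ^ 2 + 2 * decay l (ξ - η) ^ 2) := by
          refine lintegral_mono fun η => ?_
          rw [← mul_add]
          have := ENNReal.rpow_add_le_mul_rpow_add_rpow (decay l η) (decay l (ξ - η)) one_le_two
          norm_num at this
          exact this
      _ = 2 * P + 2 * P := by
          rw [lintegral_add_left (by fun_prop), lintegral_const_mul _ (by fun_prop),
            lintegral_const_mul _ (by fun_prop),
            lintegral_sub_left_eq_self (fun η => decay l η ^ 2) ξ]
      _ = _ := by ring
  calc _ ≤ (C * ∫⁻ η, (decay l η + decay l (ξ - η)) * (H η * K (ξ - η))) ^ 2 := by gcongr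
    _ ≤ C ^ 2 * ((∫⁻ η, (decay l η + decay l (ξ - η)) ^ 2) *
        ∫⁻ η, (H η * K (ξ - η)) ^ 2) := by
      rw [mul_pow]
      gcongr
      exact lintegral_mul_sq_le (by fun_prop) (by fun_prop)
    _ ≤ C ^ 2 * (4 * P * ∫⁻ η, (H η * K (ξ - η)) ^ 2) := by gcongr
    _ = _ := by simp_rw [mul_pow]; ring

open Convolution in
/-- The weighted convolution estimate behind the algebra property of `H^l`. -/
lemma lintegral_weight_smul_convolution_sq_le (B : CState m →L[ℂ] CState m →L[ℂ] CState m)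
    (h k : L2Field n m) :
    ∫⁻ ξ, ‖weight l ξ • ((fourierL2 (bessel hl h) : Space n → CState m) ⋆[B]
        (fourierL2 (bessel hl k) : Space n → CState m)) ξ‖ₑ ^ 2 ≤
      (ENNReal.ofReal (2 ^ l) * ‖B‖ₑ) ^ 2 * (4 * ∫⁻ ξ : Space n, decay l ξ ^ 2) *
        (‖h‖ₑ ^ 2 * ‖k‖ₑ ^ 2) := by
  refine (lintegral_mono (enorm_weight_smul_convolution_sq_le hl B h k)).trans_eq ?_
  rw [lintegral_const_mul_lintegral_mul_sub ((measurable_enorm_fourierL2 h).pow_const 2)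
    ((measurable_enorm_fourierL2 k).pow_const 2), lintegral_enorm_fourierL2_sq,
    lintegral_enorm_fourierL2_sq]

end Product

/-- The complexification of a real bilinear map. -/
lemma exists_complexification (β : State m →L[ℝ] State m →L[ℝ] State m) :
    ∃ B : CState m →L[ℂ] CState m →L[ℂ] CState m,
      ∀ x y, B (stateToComplex m x) (stateToComplex m y) = stateToComplex m (β x y) := by
  let e : Fin m → State m := fun i => EuclideanSpace.single i 1
  let b : CState m →ₗ[ℂ] CState m →ₗ[ℂ] CState m := LinearMap.mk₂ ℂ
    (fun z w => ∑ i, ∑ j, (z i * w j) • stateToComplex m (β (e i) (e j)))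
    (fun z z' w => by simp [add_mul, add_smul, Finset.sum_add_distrib])
    (fun c z w => by simp [mul_assoc, mul_smul, Finset.smul_sum])
    (fun z w w' => by simp [mul_add, add_smul, Finset.sum_add_distrib])
    (fun c z w => by simp [mul_left_comm _ c, mul_smul c, Finset.smul_sum])
  refine ⟨b.toContinuousBilinearMap, fun x y => ?_⟩
  have hx : ∀ x : State m, x = ∑ i, x i • e i := fun x => by
    ext j; simp [e, Pi.single_apply]
  have hc : ∀ (c : ℝ) (z : CState m), ((c : ℂ) • z) = c • z := fun c z => by
    ext j; simp
  rw [LinearMap.toContinuousBilinearMap_apply, LinearMap.mk₂_apply]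
  conv_rhs => rw [hx x, hx y]
  simp only [map_sum, map_smul, sum_apply, smul_apply,
    stateToComplex_apply, ← Complex.ofReal_mul, hc, mul_smul, Finset.smul_sum]
  rw [Finset.sum_comm]
  exact Finset.sum_congr rfl fun i _ => Finset.sum_congr rfl fun j _ => smul_comm _ _ _

section BesselProduct

variable {l : ℝ} (hl : 0 ≤ l)

-- The transform of `β(u,v)` is the convolution `W` of the transforms under the complexified `β`.
-- Since `W` is integrable and its weighted version lies in `L²`, the product has finite `H^l` norm
-- and is therefore a Bessel potential.
open Convolution in
lemma exists_bessel_eq_bilinear (hln : (n : ℝ) / 2 < l)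
    (β : State m →L[ℝ] State m →L[ℝ] State m) :
    ∃ C : ℝ, 0 ≤ C ∧ ∀ h k : L2Field n m, ∃ g : L2Field n m,
      (bessel hl g =ᵐ[volume] fun x => β (bessel hl h x) (bessel hl k x)) ∧
        ‖g‖ ≤ C * ‖h‖ * ‖k‖ := by
  obtain ⟨B, hB⟩ := exists_complexification β
  set P := ∫⁻ ξ : Space n, decay l ξ ^ 2 with hP
  have hPtop : P < ∞ := lintegral_decay_sq_lt_top hln
  set D := (ENNReal.ofReal (2 ^ l) * ‖B‖ₑ) ^ 2 * (4 * P) with hD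
  have hDtop : D < ∞ := ENNReal.mul_lt_top (ENNReal.pow_lt_top (ENNReal.mul_lt_top (by simp)
    (by simp))) (ENNReal.mul_lt_top (by simp) hPtop)
  refine ⟨√D.toReal, Real.sqrt_nonneg _, fun h k => ?_⟩
  set u := bessel hl h with hu
  set v := bessel hl k with hv
  have hui : Integrable (fourierL2 u) := integrable_fourierL2_bessel hl hln h
  have hvi : Integrable (fourierL2 v) := integrable_fourierL2_bessel hl hln k
  set W := (fourierL2 u : Space n → CState m) ⋆[B] (fourierL2 v : Space n → CState m) with hW
  have hWi : Integrable W := hui.integrable_convolution B hvi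
  have hest : eLpNorm (fun ξ => weight l ξ • W ξ) 2 volume ^ 2 ≤ D * (‖h‖ₑ ^ 2 * ‖k‖ₑ ^ 2) := by
    rw [eLpNorm_two_sq]
    exact lintegral_weight_smul_convolution_sq_le hl B h k
  have hfin : eLpNorm (fun ξ => weight l ξ • W ξ) 2 volume < ∞ := by
    have h1 := hest.trans_lt (ENNReal.mul_lt_top hDtop (ENNReal.mul_lt_top (by simp) (by simp)))
    exact (ENNReal.pow_lt_top_iff.1 h1).elim id fun h => absurd h two_ne_zero
  have hW2 : MemLp W 2 volume := by
    refine ⟨hWi.aestronglyMeasurable, (eLpNorm_mono fun ξ => ?_).trans_lt hfin⟩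
    rw [norm_smul, Real.norm_of_nonneg (weight_pos _ _).le]
    have := (weight_zero ξ).symm.trans_le (weight_mono hl ξ)
    nlinarith [norm_nonneg (W ξ)]
  have hWLi : Integrable (hW2.toLp W) := hWi.congr hW2.coeFn_toLp.symm
  -- The convolution theorem applies to integrable functions; the earlier identifications carry it
  -- over to the `L²` transforms of `u`, `v` and `W`.
  have hinv : ∀ᵐ x, (𝓕⁻ (hW2.toLp W) : CField n m) x = stateToComplex m (β (u x) (v x)) := by
    filter_upwards [ae_fourierInv_eq hWLi, ae_eq_fourierInv_fourierL2 hui,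
      ae_eq_fourierInv_fourierL2 hvi] with x h1 h2 h3
    rw [h1, Real.fourierInv_congr_ae hW2.coeFn_toLp, ← hB, h2, h3,
      Real.fourierInv_eq_fourier_neg, Real.fourierInv_eq_fourier_neg,
      Real.fourierInv_eq_fourier_neg, hW, Real.fourier_bilin_convolution_eq B hui hvi]
  have hq : MemLp (fun x => β (u x) (v x)) 2 volume := by
    refine MemLp.of_le (Lp.memLp (𝓕⁻ (hW2.toLp W) : CField n m))
      (β.aestronglyMeasurable_comp₂ (Lp.aestronglyMeasurable u) (Lp.aestronglyMeasurable v)) ?_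
    filter_upwards [hinv] with x hx
    rw [hx, norm_stateToComplex]
  have hqF : fourierL2 (hq.toLp _) = hW2.toLp W := by
    have : (stateToComplex m).compLp (hq.toLp _) = (𝓕⁻ (hW2.toLp W) : CField n m) := by
      ext1
      filter_upwards [(stateToComplex m).coeFn_compLp (hq.toLp _), hq.coeFn_toLp, hinv]
        with x h1 h2 h3
      rw [h1, h2, h3]
    rw [fourierL2, this, FourierTransform.fourier_fourierInv_eq]
  have hqS : sobolevNorm l (hq.toLp _) = eLpNorm (fun ξ => weight l ξ • W ξ) 2 volume := by
    rw [sobolevNorm_eq, hqF]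
    refine eLpNorm_congr_ae ?_
    filter_upwards [hW2.coeFn_toLp] with ξ h1
    rw [h1]
  obtain ⟨g, hg⟩ := exists_bessel_eq hl (show MemH l (hq.toLp _) from hqS.trans_lt hfin)
  refine ⟨g, hg ▸ hq.coeFn_toLp, ?_⟩
  have h1 : ‖g‖ₑ ^ 2 ≤ D * (‖h‖ₑ ^ 2 * ‖k‖ₑ ^ 2) := by
    rw [← sobolevNorm_bessel hl, hg, hqS]
    exact hest
  have h2 := ENNReal.toReal_mono (ENNReal.mul_lt_top hDtop (ENNReal.mul_lt_top (by simp)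
    (by simp))).ne h1
  simp only [ENNReal.toReal_pow, ENNReal.toReal_mul, toReal_enorm] at h2
  refine le_of_sq_le_sq ?_ (by positivity)
  rw [mul_pow, mul_pow, Real.sq_sqrt ENNReal.toReal_nonneg, mul_assoc]
  exact h2

set_option maxHeartbeats 800000 in
/-- `H^l` is closed under bilinear operations: in terms of Bessel potentials, a bilinear operation
on states lifts to a bounded bilinear operation on `L²`. -/
theorem exists_bilinear_lift (hln : (n : ℝ) / 2 < l)
    (β : State m →L[ℝ] State m →L[ℝ] State m) :
    ∃ G : L2Field n m →L[ℝ] L2Field n m →L[ℝ] L2Field n m, ∀ h k,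
      bessel hl (G h k) =ᵐ[volume] fun x => β (bessel hl h x) (bessel hl k x) := by
  obtain ⟨C, hC0, hC⟩ := exists_bessel_eq_bilinear hl hln β
  choose G hG hGn using hC
  let b : L2Field n m →ₗ[ℝ] L2Field n m →ₗ[ℝ] L2Field n m := LinearMap.mk₂ ℝ G
    (fun h h' k => by
      apply bessel_injective hl
      ext1
      rw [map_add]
      have h0 := hG (h + h') k
      rw [map_add] at h0
      filter_upwards [h0, hG h k, hG h' k, Lp.coeFn_add (bessel hl (G h k)) (bessel hl (G h' k)),
        Lp.coeFn_add (bessel hl h) (bessel hl h')] with x h1 h2 h3 h4 h5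
      rw [h1, h4, h5, Pi.add_apply, Pi.add_apply, h2, h3, map_add, add_apply])
    (fun c h k => by
      apply bessel_injective hl
      ext1
      rw [map_smul]
      have h0 := hG (c • h) k
      rw [map_smul] at h0
      filter_upwards [h0, hG h k, Lp.coeFn_smul c (bessel hl (G h k)),
        Lp.coeFn_smul c (bessel hl h)] with x h1 h2 h3 h4
      rw [h1, h3, h4, Pi.smul_apply, Pi.smul_apply, h2, map_smul, smul_apply])
    (fun h k k' => by
      apply bessel_injective hl
      ext1
      rw [map_add]
      have h0 := hG h (k + k')
      rw [map_add] at h0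
      filter_upwards [h0, hG h k, hG h k', Lp.coeFn_add (bessel hl (G h k)) (bessel hl (G h k')),
        Lp.coeFn_add (bessel hl k) (bessel hl k')] with x h1 h2 h3 h4 h5
      rw [h1, h4, h5, Pi.add_apply, Pi.add_apply, h2, h3, map_add])
    (fun c h k => by
      apply bessel_injective hl
      ext1
      rw [map_smul]
      have h0 := hG h (c • k)
      rw [map_smul] at h0
      filter_upwards [h0, hG h k, Lp.coeFn_smul c (bessel hl (G h k)),
        Lp.coeFn_smul c (bessel hl k)] with x h1 h2 h3 h4
      rw [h1, h3, h4, Pi.smul_apply, Pi.smul_apply, h2, map_smul])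
  exact ⟨b.mkContinuous₂ C hGn, hG⟩

end BesselProduct

/-! ### The collision operators -/

namespace Model

variable (B : Model n m) (M : State m)

lemma Q_apply (F G : State m) (i : Fin m) : B.Q F G i = 1 / (2 * B.α i) * ∑ j, ∑ k, ∑ l,
    (B.A i j k l * (F k * G l + F l * G k) - B.A k l i j * (F i * G j + F j * G i)) := rfl

lemma Q_comm (F G : State m) : B.Q F G = B.Q G F := by
  ext i
  rw [Q_apply, Q_apply]
  refine congrArg _ (Finset.sum_congr rfl fun j _ => Finset.sum_congr rfl fun k _ =>
    Finset.sum_congr rfl fun l _ => ?_)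
  ring

lemma Q_add_left (F F' G : State m) : B.Q (F + F') G = B.Q F G + B.Q F' G := by
  ext i
  rw [PiLp.add_apply, Q_apply, Q_apply, Q_apply, ← mul_add]
  simp only [← Finset.sum_add_distrib]
  refine congrArg _ (Finset.sum_congr rfl fun j _ => Finset.sum_congr rfl fun k _ =>
    Finset.sum_congr rfl fun l _ => ?_)
  simp only [PiLp.add_apply]
  ring

lemma Q_smul_left (c : ℝ) (F G : State m) : B.Q (c • F) G = c • B.Q F G := by
  ext i
  rw [PiLp.smul_apply, smul_eq_mul, Q_apply, Q_apply, mul_left_comm]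
  simp only [Finset.mul_sum]
  refine Finset.sum_congr rfl fun j _ => Finset.sum_congr rfl fun k _ =>
    Finset.sum_congr rfl fun l _ => ?_
  simp only [PiLp.smul_apply, smul_eq_mul]
  ring

lemma sqrtΛ_apply (f : State m) (i : Fin m) : B.sqrtΛ M f i = √(M i / B.α i) * f i := rfl

lemma invSqrtΛ_apply (f : State m) (i : Fin m) :
    B.invSqrtΛ M f i = (√(M i / B.α i))⁻¹ * f i := rfl

lemma sqrtΛ_add (f g : State m) : B.sqrtΛ M (f + g) = B.sqrtΛ M f + B.sqrtΛ M g := by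
  ext i; simp [sqrtΛ_apply, mul_add]

lemma sqrtΛ_smul (c : ℝ) (f : State m) : B.sqrtΛ M (c • f) = c • B.sqrtΛ M f := by
  ext i; simp [sqrtΛ_apply, mul_left_comm]

lemma invSqrtΛ_add (f g : State m) : B.invSqrtΛ M (f + g) = B.invSqrtΛ M f + B.invSqrtΛ M g := by
  ext i; simp [invSqrtΛ_apply, mul_add]

lemma invSqrtΛ_smul (c : ℝ) (f : State m) : B.invSqrtΛ M (c • f) = c • B.invSqrtΛ M f := by
  ext i; simp [invSqrtΛ_apply, mul_left_comm]

lemma Γ_comm (f g : State m) : B.Γ M f g = B.Γ M g f := by rw [Γ, Γ, Q_comm]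

/-- `Γ` as a bilinear map. -/
def gamma : State m →L[ℝ] State m →L[ℝ] State m :=
  (LinearMap.mk₂ ℝ (B.Γ M)
    (fun f f' g => by rw [Γ, Γ, Γ, sqrtΛ_add, Q_add_left, invSqrtΛ_add])
    (fun c f g => by rw [Γ, Γ, sqrtΛ_smul, Q_smul_left, invSqrtΛ_smul])
    (fun f g g' => by
      rw [Γ_comm, Γ_comm B M f g, Γ_comm B M f g', Γ, Γ, Γ, sqrtΛ_add, Q_add_left, invSqrtΛ_add])
    (fun c f g => by
      rw [Γ_comm, Γ_comm B M f g, Γ, Γ, sqrtΛ_smul, Q_smul_left,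
        invSqrtΛ_smul])).toContinuousBilinearMap

/-- `L` as a linear map. -/
def lin : State m →ₗ[ℝ] State m where
  toFun := B.L M
  map_add' f g := by
    rw [L, L, L, sqrtΛ_add, Q_comm, Q_add_left, invSqrtΛ_add, smul_add, Q_comm B M (B.sqrtΛ M f),
      Q_comm B M (B.sqrtΛ M g)]
  map_smul' c f := by
    rw [L, L, sqrtΛ_smul, Q_comm, Q_smul_left, invSqrtΛ_smul, smul_comm, Q_comm B M (B.sqrtΛ M f),
      RingHom.id_apply]

lemma lin_apply (f : State m) : B.lin M f = B.L M f := rfl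

/-- The coordinates `f_i / √(M_i α_i)`. -/
def ratio (f : State m) (i : Fin m) : ℝ := √(M i / B.α i) * f i / M i

/-- The increment `φ_i + φ_j - φ_k - φ_l` in a collision. -/
def increment (φ : Fin m → ℝ) (i j k l : Fin m) : ℝ := φ i + φ j - φ k - φ l

variable {B M}

/-- Sums against quantities with the symmetries of a collision see only the increments. -/
lemma sum_mul_eq_sum_mul_increment {T : Fin m → Fin m → Fin m → Fin m → ℝ}
    (h1 : ∀ i j k l, T j i k l = T i j k l) (h2 : ∀ i j k l, T k l i j = -T i j k l)
    (ψ : Fin m → ℝ) :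
    ∑ i, ∑ j, ∑ k, ∑ l, T i j k l * ψ i =
      1 / 4 * ∑ i, ∑ j, ∑ k, ∑ l, T i j k l * increment ψ i j k l := by
  have e1 : ∑ i, ∑ j, ∑ k, ∑ l, T i j k l * ψ j = ∑ i, ∑ j, ∑ k, ∑ l, T i j k l * ψ i := by
    rw [Finset.sum_comm]
    simp only [h1]
  have swap : ∀ f : Fin m → Fin m → Fin m → Fin m → ℝ,
      ∑ i, ∑ j, ∑ k, ∑ l, f i j k l = ∑ i, ∑ j, ∑ k, ∑ l, f k l i j := fun f => by
    have h : ∀ f : Fin m → Fin m → Fin m → Fin m → ℝ, ∑ i, ∑ j, ∑ k, ∑ l, f i j k l =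
        ∑ p : Fin m × Fin m, ∑ q : Fin m × Fin m, f p.1 p.2 q.1 q.2 := fun f => by
      simp only [Fintype.sum_prod_type]
    rw [h, h, Finset.sum_comm]
  have e2 : ∑ i, ∑ j, ∑ k, ∑ l, T i j k l * ψ k = -∑ i, ∑ j, ∑ k, ∑ l, T i j k l * ψ i := by
    rw [swap]
    simp only [← Finset.sum_neg_distrib]
    refine Finset.sum_congr rfl fun i _ => Finset.sum_congr rfl fun j _ =>
      Finset.sum_congr rfl fun k _ => Finset.sum_congr rfl fun l _ => ?_
    rw [h2, neg_mul]
  have e3 : ∑ i, ∑ j, ∑ k, ∑ l, T i j k l * ψ l = -∑ i, ∑ j, ∑ k, ∑ l, T i j k l * ψ i := by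
    rw [swap, ← e1]
    simp only [← Finset.sum_neg_distrib]
    refine Finset.sum_congr rfl fun i _ => Finset.sum_congr rfl fun j _ =>
      Finset.sum_congr rfl fun k _ => Finset.sum_congr rfl fun l _ => ?_
    rw [h2, neg_mul]
  simp only [increment, mul_sub, mul_add, Finset.sum_sub_distrib, Finset.sum_add_distrib, e1, e2,
    e3]
  ring

/-- The weak form of the collision operator. Reversibility makes gain minus loss antisymmetric under
exchange of `(i,j)` and `(k,l)`, so symmetrization applies; `1/8` is `1/2` from `Q` times `1/4` from
symmetrization. -/
lemma inner_invSqrtΛ_Q (hB : B.SymmetricRates) (hM : B.IsMaxwellian M) (F G g : State m) :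
    inner ℝ (B.invSqrtΛ M (B.Q F G)) g = 1 / 8 * ∑ i, ∑ j, ∑ k, ∑ l,
      B.A i j k l * ((F k * G l + F l * G k) - (F i * G j + F j * G i)) *
        increment (B.ratio M g) i j k l := by
  have h := sum_mul_eq_sum_mul_increment
    (T := fun i j k l => B.A i j k l * ((F k * G l + F l * G k) - (F i * G j + F j * G i)))
    (fun i j k l => by rw [hB.swap_upper]; ring)
    (fun i j k l => by rw [hB.reverse]; ring) (B.ratio M g)
  have h' : inner ℝ (B.invSqrtΛ M (B.Q F G)) g = 1 / 2 * ∑ i, ∑ j, ∑ k, ∑ l,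
      B.A i j k l * ((F k * G l + F l * G k) - (F i * G j + F j * G i)) * B.ratio M g i := by
    rw [PiLp.inner_apply, Finset.mul_sum]
    refine Finset.sum_congr rfl fun i _ => ?_
    simp only [← Finset.sum_mul]
    rw [invSqrtΛ_apply, Q_apply, ratio]
    have hMi := hM.pos i
    have hα := B.α_pos i
    have hc : 0 < √(M i / B.α i) := Real.sqrt_pos.2 (div_pos hMi hα)
    have hcc : √(M i / B.α i) ^ 2 * B.α i = M i := by
      rw [Real.sq_sqrt (div_pos hMi hα).le, div_mul_cancel₀ _ hα.ne']
    simp only [hB.reverse i, ← mul_sub]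
    generalize ∑ j, ∑ k, ∑ l, B.A i j k l * (F k * G l + F l * G k - (F i * G j + F j * G i)) = S
    have hc' : (√(M i / B.α i))⁻¹ * (1 / (2 * B.α i)) = 1 / 2 * (√(M i / B.α i) / M i) := by
      generalize √(M i / B.α i) = c at hc hcc ⊢
      field_simp
      exact hcc.symm
    simp only [RCLike.inner_apply, conj_trivial]
    linear_combination (g i * S) * hc'
  rw [h', h]
  ring

/-- Since `Λ^{1/2} f` is `M` times the ratios, detailed balance lets `M_i M_j` replace `M_k M_l` and
the bracket becomes `-M_i M_j` times the increment. Symmetry and nonnegativity of `L` can be read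
off. -/
lemma inner_L (hB : B.SymmetricRates) (hM : B.IsMaxwellian M) (f g : State m) :
    inner ℝ (B.L M f) g = 1 / 4 * ∑ i, ∑ j, ∑ k, ∑ l, B.A i j k l * (M i * M j) *
      (increment (B.ratio M f) i j k l * increment (B.ratio M g) i j k l) := by
  rw [L, inner_smul_left, inner_invSqrtΛ_Q hB hM, conj_trivial]
  simp only [Finset.mul_sum]
  refine Finset.sum_congr rfl fun i _ => Finset.sum_congr rfl fun j _ =>
    Finset.sum_congr rfl fun k _ => Finset.sum_congr rfl fun l _ => ?_
  have hr : ∀ i, B.sqrtΛ M f i = M i * B.ratio M f i := fun i => by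
    rw [sqrtΛ_apply, ratio, mul_div_cancel₀ _ (hM.pos i).ne']
  have hb := hM.balance i j k l
  simp only [hr, increment]
  linear_combination (1 / 4 * (B.ratio M f k + B.ratio M f l) * (B.ratio M g i + B.ratio M g j
    - B.ratio M g k - B.ratio M g l)) * hb

lemma L_isSymmetric (hB : B.SymmetricRates) (hM : B.IsMaxwellian M) :
    (B.lin M).IsSymmetric := fun f g => by
  rw [real_inner_comm (B.lin M g), lin_apply, lin_apply, inner_L hB hM, inner_L hB hM]
  simp only [mul_comm (increment (B.ratio M f) _ _ _ _)]

lemma inner_L_nonneg (hB : B.SymmetricRates) (hM : B.IsMaxwellian M) (f : State m) :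
    0 ≤ inner ℝ (B.L M f) f := by
  rw [inner_L hB hM]
  refine mul_nonneg (by norm_num) (Finset.sum_nonneg fun i _ => Finset.sum_nonneg fun j _ =>
    Finset.sum_nonneg fun k _ => Finset.sum_nonneg fun l _ => ?_)
  exact mul_nonneg (mul_nonneg (B.A_nonneg _ _ _ _) (mul_pos (hM.pos i) (hM.pos j)).le)
    (mul_self_nonneg _)

/-- If `L h = 0`, a sum of nonnegative terms vanishes, so the increment of `h` is zero in every
collision of positive rate; these increments are factors in the weak form of `Γ`. -/
lemma inner_Γ_eq_zero (hB : B.SymmetricRates) (hM : B.IsMaxwellian M) {h : State m}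
    (hh : B.L M h = 0) (f g : State m) : inner ℝ (B.Γ M f g) h = 0 := by
  have h0 := inner_L hB hM h h
  rw [hh, inner_zero_left, eq_comm, mul_eq_zero_iff_left (by norm_num)] at h0
  have hnn : ∀ i j k l, 0 ≤ B.A i j k l * (M i * M j) *
      (increment (B.ratio M h) i j k l * increment (B.ratio M h) i j k l) := fun i j k l =>
    mul_nonneg (mul_nonneg (B.A_nonneg _ _ _ _) (mul_pos (hM.pos i) (hM.pos j)).le)
      (mul_self_nonneg _)
  have hz : ∀ i j k l, B.A i j k l * increment (B.ratio M h) i j k l = 0 := fun i j k l => by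
    rw [Finset.sum_eq_zero_iff_of_nonneg fun i _ => Finset.sum_nonneg fun j _ =>
      Finset.sum_nonneg fun k _ => Finset.sum_nonneg fun l _ => hnn i j k l] at h0
    have h1 := h0 i (Finset.mem_univ _)
    rw [Finset.sum_eq_zero_iff_of_nonneg fun j _ =>
      Finset.sum_nonneg fun k _ => Finset.sum_nonneg fun l _ => hnn i j k l] at h1
    have h2 := h1 j (Finset.mem_univ _)
    rw [Finset.sum_eq_zero_iff_of_nonneg fun k _ => Finset.sum_nonneg fun l _ => hnn i j k l] at h2
    have h2 := h2 k (Finset.mem_univ _)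
    rw [Finset.sum_eq_zero_iff_of_nonneg fun l _ => hnn i j k l] at h2
    have h4 := h2 l (Finset.mem_univ _)
    have hMM := (mul_pos (hM.pos i) (hM.pos j)).ne'
    simpa [hMM] using h4
  rw [Γ, inner_invSqrtΛ_Q hB hM]
  simp only [mul_right_comm _ _ (increment _ _ _ _ _), hz, zero_mul, Finset.sum_const_zero,
    mul_zero]

/-- The collision invariants are orthogonal to `Γ`, so that `Γ` factors through `L`. -/
lemma exists_gamma_eq_lin_comp (hB : B.SymmetricRates) (hM : B.IsMaxwellian M) :
    ∃ β : State m →L[ℝ] State m →L[ℝ] State m, ∀ f g, B.L M (β f g) = B.Γ M f g := by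
  -- In finite dimension the range of a symmetric map is the orthogonal complement of its kernel.
  have hmem : ∀ f g, B.Γ M f g ∈ LinearMap.range (B.lin M) := fun f g => by
    rw [← Submodule.orthogonal_orthogonal (LinearMap.range (B.lin M)),
      (L_isSymmetric hB hM).orthogonal_range, Submodule.mem_orthogonal']
    exact fun h hh => inner_Γ_eq_zero hB hM hh f g
  obtain ⟨R, hR⟩ := (B.lin M).rangeRestrict.exists_rightInverse_of_surjective
    (LinearMap.range_rangeRestrict _)
  -- Any linear extension of the right inverse serves, as only its values on the range matter.
  obtain ⟨P, hP⟩ := R.exists_extend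
  refine ⟨(ContinuousLinearMap.compL ℝ (State m) (State m) (State m)
    (LinearMap.toContinuousLinearMap P)).comp (B.gamma M), fun f g => ?_⟩
  change B.L M (P (B.Γ M f g)) = _
  have h1 : P (B.Γ M f g) = R ⟨_, hmem f g⟩ := LinearMap.congr_fun hP ⟨_, hmem f g⟩
  have h2 := congrArg Subtype.val (LinearMap.congr_fun hR ⟨_, hmem f g⟩)
  rw [h1]
  exact h2

end Model

/-! ### The transport group -/

section Transport

variable (c : Fin m → Space n)

/-- The symbol of the transport group. -/
def transportSymbol (t : ℝ) (ξ : Space n) (i : Fin m) : ℂ :=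
  Complex.exp (((-(2 * Real.pi * (t * inner ℝ (c i) ξ)) : ℝ) : ℂ) * Complex.I)

lemma norm_transportSymbol (t : ℝ) (ξ : Space n) (i : Fin m) : ‖transportSymbol c t ξ i‖ = 1 :=
  Complex.norm_exp_ofReal_mul_I _

lemma isSymbol_transport (t : ℝ) : IsSymbol (transportSymbol c t) 1 where
  measurable i := by
    unfold transportSymbol
    fun_prop
  bound ξ i := (norm_transportSymbol c t ξ i).le
  symm ξ i := by
    rw [transportSymbol, transportSymbol, ← Complex.exp_conj, map_mul, Complex.conj_ofReal,
      Complex.conj_I, inner_neg_right]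
    push_cast
    ring_nf
  nonneg := zero_le_one

/-- The transport group: the `i`-th component is translated by `t c_i`. -/
def transport (t : ℝ) : L2Field n m →L[ℝ] L2Field n m := (isSymbol_transport c t).multiplier

lemma fourierL2_transport (t : ℝ) (u : L2Field n m) :
    fourierL2 (transport c t u) =ᵐ[volume] fun ξ => diag (transportSymbol c t ξ) (fourierL2 u ξ) :=
  (isSymbol_transport c t).fourierL2_multiplier u

lemma transport_bessel {l : ℝ} (hl : 0 ≤ l) (t : ℝ) (u : L2Field n m) :
    transport c t (bessel hl u) = bessel hl (transport c t u) :=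
  (isSymbol_transport c t).multiplier_comm (isSymbol_weight hl) u

lemma norm_diag_of_norm_eq_one {a : Fin m → ℂ} (ha : ∀ i, ‖a i‖ = 1) (z : CState m) :
    ‖diag a z‖ = ‖z‖ := by
  simp [EuclideanSpace.norm_eq, ha]

lemma norm_transport (t : ℝ) (u : L2Field n m) : ‖transport c t u‖ = ‖u‖ := by
  rw [← norm_fourierL2, ← norm_fourierL2 u, Lp.norm_def, Lp.norm_def]
  congr 1
  refine eLpNorm_congr_norm_ae ?_
  filter_upwards [fourierL2_transport c t u] with ξ h
  rw [h, norm_diag_of_norm_eq_one (norm_transportSymbol c t ξ)]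

lemma transport_zero (u : L2Field n m) : transport c 0 u = u := by
  apply fourierL2_injective
  ext1
  filter_upwards [fourierL2_transport c 0 u] with ξ h
  rw [h]
  ext i
  simp [transportSymbol]

lemma transport_add (s t : ℝ) (u : L2Field n m) :
    transport c (s + t) u = transport c s (transport c t u) := by
  apply fourierL2_injective
  ext1
  filter_upwards [fourierL2_transport c (s + t) u, fourierL2_transport c s (transport c t u),
    fourierL2_transport c t u] with ξ h1 h2 h3
  rw [h1, h2, h3]
  ext i
  rw [diag_apply, diag_apply, diag_apply, ← mul_assoc, transportSymbol, transportSymbol,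
    transportSymbol, ← Complex.exp_add]
  congr 2
  push_cast
  ring

/-! ### The transport group on test fields -/

/-- The projection onto the `i`-th coordinate axis. -/
def coordProj (i : Fin m) : State m →L[ℝ] State m :=
  (EuclideanSpace.proj i : State m →L[ℝ] ℝ).smulRight (EuclideanSpace.single i 1)

lemma sum_coordProj_apply (z : Fin m → State m) (i : Fin m) :
    (∑ j, coordProj j (z j)) i = z i i := by
  simp [coordProj, Pi.single_apply]

/-- The action of the transport group on test fields. -/
def transportTest (t : ℝ) (φ : 𝓢(Space n, State m)) : 𝓢(Space n, State m) :=
  ∑ i, (SchwartzMap.compSubConstCLM ℝ (t • c i) φ).postcompCLM (coordProj i)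

/-- The generator `(c_i · ∇ φ_i)_i` of the transport group, up to sign. -/
def advect (φ : 𝓢(Space n, State m)) : 𝓢(Space n, State m) :=
  ∑ i, (LineDeriv.lineDerivOp (c i) φ).postcompCLM (coordProj i)

lemma schwartz_sum_apply {ι F : Type*} [NormedAddCommGroup F] [NormedSpace ℝ F] (s : Finset ι)
    (f : ι → 𝓢(Space n, F)) (x : Space n) : (∑ i ∈ s, f i) x = ∑ i ∈ s, f i x := by
  classical
  induction s using Finset.induction_on with
  | empty => simp
  | insert a s ha ih => rw [Finset.sum_insert ha, Finset.sum_insert ha, add_apply, ih]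

lemma transportTest_apply (t : ℝ) (φ : 𝓢(Space n, State m)) (x : Space n) (i : Fin m) :
    transportTest c t φ x i = φ (x - t • c i) i := by
  rw [transportTest, schwartz_sum_apply]
  simp only [SchwartzMap.postcompCLM_apply]
  rw [sum_coordProj_apply (fun j => SchwartzMap.compSubConstCLM ℝ (t • c j) φ x),
    SchwartzMap.compSubConstCLM_apply]

lemma advect_apply (φ : 𝓢(Space n, State m)) (x : Space n) (i : Fin m) :
    advect c φ x i = (fderiv ℝ φ x (c i)) i := by
  rw [advect, schwartz_sum_apply]
  simp only [SchwartzMap.postcompCLM_apply]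
  rw [sum_coordProj_apply (fun j => LineDeriv.lineDerivOp (c j) φ x),
    SchwartzMap.lineDerivOp_apply_eq_fderiv]

/-- A test field as an element of `L²`. -/
abbrev testL2 (φ : 𝓢(Space n, State m)) : L2Field n m := φ.toLp 2 volume

/-- The complex field underlying a real test field. -/
def complexTest (φ : 𝓢(Space n, State m)) : 𝓢(Space n, CState m) :=
  φ.postcompCLM (stateToComplex m)

lemma complexTest_apply (φ : 𝓢(Space n, State m)) (x : Space n) :
    complexTest φ x = stateToComplex m (φ x) := SchwartzMap.postcompCLM_apply _ _ _

lemma fourierL2_testL2 (φ : 𝓢(Space n, State m)) :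
    fourierL2 (testL2 φ) =ᵐ[volume] ⇑(𝓕 (complexTest φ) : 𝓢(Space n, CState m)) := by
  have : (stateToComplex m).compLp (testL2 φ) = (complexTest φ).toLp 2 volume := by
    ext1
    filter_upwards [(stateToComplex m).coeFn_compLp (testL2 φ), φ.coeFn_toLp 2 volume,
      (complexTest φ).coeFn_toLp 2 volume] with x h1 h2 h3
    rw [h1, h2, h3, complexTest_apply]
  rw [fourierL2, this, SchwartzMap.toLp_fourier_eq]
  exact SchwartzMap.coeFn_toLp _ _ _

lemma fourier_schwartz_apply (ψ : 𝓢(Space n, CState m)) (ξ : Space n) (i : Fin m) :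
    𝓕 ψ ξ i = ∫ x, Real.fourierChar (-inner ℝ x ξ) • ψ x i := by
  rw [SchwartzMap.fourier_coe, Real.fourier_eq]
  exact ((EuclideanSpace.proj (𝕜 := ℂ) i).integral_comp_comm
    ((Real.fourierIntegral_convergent_iff _).2 ψ.integrable)).symm

lemma fourier_complexTest_transportTest (t : ℝ) (φ : 𝓢(Space n, State m)) (ξ : Space n) :
    𝓕 (complexTest (transportTest c t φ)) ξ =
      diag (transportSymbol c t ξ) (𝓕 (complexTest φ) ξ) := by
  ext i
  rw [diag_apply, fourier_schwartz_apply, fourier_schwartz_apply, ← integral_const_mul,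
    ← integral_add_right_eq_self _ (t • c i)]
  congr 1 with x
  rw [complexTest_apply, complexTest_apply, stateToComplex_apply, stateToComplex_apply,
    transportTest_apply, add_sub_cancel_right, Circle.smul_def, Circle.smul_def,
    smul_eq_mul, smul_eq_mul, ← mul_assoc]
  congr 1
  rw [Real.fourierChar_apply, Real.fourierChar_apply, transportSymbol, ← Complex.exp_add,
    inner_add_left, real_inner_smul_left]
  congr 1
  push_cast
  ring

lemma transport_testL2 (t : ℝ) (φ : 𝓢(Space n, State m)) :
    transport c t (testL2 φ) = testL2 (transportTest c t φ) := by
  apply fourierL2_injective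
  ext1
  filter_upwards [fourierL2_transport c t (testL2 φ), fourierL2_testL2 φ,
    fourierL2_testL2 (transportTest c t φ)] with ξ h1 h2 h3
  rw [h1, h2, h3, fourier_complexTest_transportTest]

lemma fourier_complexTest_advect (φ : 𝓢(Space n, State m)) (ξ : Space n) :
    𝓕 (complexTest (advect c φ)) ξ =
      diag (fun i => ((2 * Real.pi * inner ℝ (c i) ξ : ℝ) : ℂ) * Complex.I)
        (𝓕 (complexTest φ) ξ) := by
  ext i
  have h1 : 𝓕 (complexTest (advect c φ)) ξ i =
      𝓕 (LineDeriv.lineDerivOp (c i) (complexTest φ)) ξ i := by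
    rw [fourier_schwartz_apply, fourier_schwartz_apply]
    congr 1 with x
    congr 1
    rw [complexTest_apply, stateToComplex_apply, advect_apply,
      SchwartzMap.lineDerivOp_apply_eq_fderiv]
    have h2 : HasFDerivAt (complexTest φ) ((stateToComplex m).comp (fderiv ℝ φ x)) x := by
      have := (stateToComplex m).hasFDerivAt.comp x φ.differentiableAt.hasFDerivAt
      exact this
    rw [h2.fderiv]
    rfl
  rw [h1, SchwartzMap.fourier_lineDerivOp_eq, smul_apply,
    SchwartzMap.smulLeftCLM_apply_apply (by fun_prop), PiLp.smul_apply, PiLp.smul_apply, diag_apply,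
    real_inner_comm]
  simp only [smul_eq_mul, Complex.real_smul]
  push_cast
  ring

lemma fourierL2_testL2_advect (φ : 𝓢(Space n, State m)) :
    fourierL2 (testL2 (advect c φ)) =ᵐ[volume] fun ξ =>
      diag (fun i => ((2 * Real.pi * inner ℝ (c i) ξ : ℝ) : ℂ) * Complex.I)
        (fourierL2 (testL2 φ) ξ) := by
  filter_upwards [fourierL2_testL2 φ, fourierL2_testL2 (advect c φ)] with ξ h1 h2
  rw [h1, h2, fourier_complexTest_advect]

/-- Taylor's formula for `|θ| ≤ 1`; for larger `θ` the crude bound `2|θ| ≤ 2θ²`. -/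
lemma norm_exp_sub_one_sub_le (θ : ℝ) :
    ‖Complex.exp (θ * Complex.I) - 1 - θ * Complex.I‖ ≤ 2 * θ ^ 2 := by
  have hn : ‖(θ : ℂ) * Complex.I‖ = |θ| := by simp
  rcases le_or_gt |θ| 1 with h | h
  · refine (Complex.norm_exp_sub_one_sub_id_le (hn.trans_le h)).trans ?_
    rw [hn, sq_abs]
    nlinarith [sq_nonneg θ]
  · refine (norm_sub_le _ _).trans ?_
    have h1 : ‖Complex.exp (θ * Complex.I) - 1‖ ≤ |θ| := by
      rw [mul_comm]
      exact Real.norm_exp_I_mul_ofReal_sub_one_le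
    rw [hn, ← sq_abs]
    nlinarith

lemma norm_toLp_le_of_forall_norm_le {z w : CState m} {K : ℝ} (hK : 0 ≤ K)
    (h : ∀ i, ‖z i‖ ≤ K * ‖w i‖) : ‖z‖ ≤ K * ‖w‖ := by
  rw [EuclideanSpace.norm_eq, EuclideanSpace.norm_eq, ← Real.sqrt_sq hK,
    ← Real.sqrt_mul (sq_nonneg K), Finset.mul_sum]
  refine Real.sqrt_le_sqrt (Finset.sum_le_sum fun i _ => ?_)
  rw [← mul_pow]
  gcongr
  exact h i

lemma norm_transport_testL2_sub_le (t : ℝ) (φ : 𝓢(Space n, State m)) :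
    ‖transport c t (testL2 φ) - testL2 φ‖ ≤ |t| * ‖testL2 (advect c φ)‖ := by
  rw [← norm_fourierL2, ← norm_fourierL2 (testL2 (advect c φ)), fourierL2_sub]
  refine Lp.norm_le_mul_norm_of_ae_le_mul ?_
  filter_upwards [fourierL2_transport c t (testL2 φ), fourierL2_testL2_advect c φ,
    Lp.coeFn_sub (fourierL2 (transport c t (testL2 φ))) (fourierL2 (testL2 φ))] with ξ h1 h2 h3
  rw [h3, Pi.sub_apply, h1, h2]
  refine norm_toLp_le_of_forall_norm_le (abs_nonneg t) fun i => ?_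
  rw [PiLp.sub_apply, diag_apply, diag_apply, ← sub_one_mul, norm_mul, norm_mul, ← mul_assoc]
  gcongr
  rw [transportSymbol, mul_comm _ Complex.I]
  refine Real.norm_exp_I_mul_ofReal_sub_one_le.trans_eq ?_
  simp [mul_left_comm]

/-- On the Fourier side the quadratic remainder is bounded by `θ²`, and the frequency factor in `θ²`
is the modulus of the symbol of `advect` applied twice. -/
lemma norm_transport_testL2_taylor_le (t : ℝ) (φ : 𝓢(Space n, State m)) :
    ‖transport c t (testL2 φ) - testL2 φ + t • testL2 (advect c φ)‖ ≤
      2 * t ^ 2 * ‖testL2 (advect c (advect c φ))‖ := by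
  rw [← norm_fourierL2, ← norm_fourierL2 (testL2 (advect c (advect c φ))), fourierL2_add,
    fourierL2_sub, fourierL2_smul]
  refine Lp.norm_le_mul_norm_of_ae_le_mul ?_
  filter_upwards [fourierL2_transport c t (testL2 φ), fourierL2_testL2_advect c φ,
    fourierL2_testL2_advect c (advect c φ),
    Lp.coeFn_sub (fourierL2 (transport c t (testL2 φ))) (fourierL2 (testL2 φ)),
    Lp.coeFn_add (fourierL2 (transport c t (testL2 φ)) - fourierL2 (testL2 φ))
      (t • fourierL2 (testL2 (advect c φ))),
    Lp.coeFn_smul t (fourierL2 (testL2 (advect c φ)))] with ξ h1 h2 h3 h4 h5 h6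
  rw [h5, Pi.add_apply, h4, Pi.sub_apply, h6, Pi.smul_apply, h1, h3, h2]
  refine norm_toLp_le_of_forall_norm_le (by positivity) fun i => ?_
  set θ : ℝ := -(2 * Real.pi * (t * inner ℝ (c i) ξ)) with hθ
  have h7 := norm_exp_sub_one_sub_le θ
  have h8 : (diag (transportSymbol c t ξ) (fourierL2 (testL2 φ) ξ) - fourierL2 (testL2 φ) ξ +
      t • diag (fun i => ((2 * Real.pi * inner ℝ (c i) ξ : ℝ) : ℂ) * Complex.I)
        (fourierL2 (testL2 φ) ξ)) i =
      (Complex.exp (θ * Complex.I) - 1 - θ * Complex.I) * fourierL2 (testL2 φ) ξ i := by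
    rw [PiLp.add_apply, PiLp.sub_apply, PiLp.smul_apply, diag_apply, diag_apply, transportSymbol,
      Complex.real_smul, ← hθ]
    have : (θ : ℂ) = -(2 * Real.pi * (t * (inner ℝ (c i) ξ : ℝ))) := by rw [hθ]; push_cast; ring
    generalize Complex.exp (θ * Complex.I) = e
    rw [this]
    push_cast
    ring
  have h9 : θ = -(t * (2 * Real.pi * inner ℝ (c i) ξ)) := by rw [hθ]; ring
  rw [h8, norm_mul, diag_apply, diag_apply]
  generalize 2 * Real.pi * inner ℝ (c i) ξ = r at h9 ⊢
  have h10 : ‖(r : ℂ) * Complex.I‖ = |r| := by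
    rw [norm_mul, Complex.norm_I, mul_one, Complex.norm_real, Real.norm_eq_abs]
  have h11 : ∀ z : ℂ, ‖(r : ℂ) * Complex.I * ((r : ℂ) * Complex.I * z)‖ = r ^ 2 * ‖z‖ := fun z => by
    rw [← mul_assoc, norm_mul, norm_mul (_ * _) (_ * _), h10, abs_mul_abs_self, sq]
  rw [h11, ← mul_assoc]
  gcongr
  refine h7.trans_eq ?_
  rw [h9]
  ring

/-- At time zero, approximate by test fields, the isometry property keeping the error small; the
group law moves the statement to other times. -/
lemma continuous_transport (u : L2Field n m) : Continuous fun t => transport c t u := by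
  have h0 : Tendsto (fun t => transport c t u) (𝓝 0) (𝓝 u) := by
    rw [Metric.tendsto_nhds]
    intro ε hε
    obtain ⟨v, hv, hvu⟩ := Metric.dense_iff.1 (SchwartzMap.denseRange_toLpCLM (E := Space n)
      (F := State m) (p := 2) (μ := volume) ENNReal.ofNat_ne_top) u (ε / 3) (by positivity)
    obtain ⟨φ, rfl⟩ := hvu
    rw [Metric.mem_ball, dist_eq_norm, SchwartzMap.toLpCLM_apply] at hv
    have h1 : Tendsto (fun t : ℝ => |t| * ‖testL2 (advect c φ)‖) (𝓝 0) (𝓝 0) := by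
      have : Continuous fun t : ℝ => |t| * ‖testL2 (advect c φ)‖ := by fun_prop
      simpa using this.tendsto 0
    filter_upwards [h1.eventually_lt_const (show 0 < ε / 3 by positivity)] with t ht
    have h2 := norm_transport_testL2_sub_le c t φ
    have h3 : ‖transport c t (testL2 φ - u)‖ < ε / 3 := by rwa [norm_transport]
    rw [dist_eq_norm]
    calc ‖transport c t u - u‖ = ‖-(transport c t (testL2 φ - u)) +
          ((transport c t (testL2 φ) - testL2 φ) + (testL2 φ - u))‖ := by
          rw [map_sub]; congr 1; abel
      _ ≤ ‖transport c t (testL2 φ - u)‖ + (‖transport c t (testL2 φ) - testL2 φ‖ +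
          ‖testL2 φ - u‖) := by
          refine (norm_add_le _ _).trans ?_
          rw [norm_neg]
          gcongr
          exact norm_add_le _ _
      _ < ε := by linarith
  refine continuous_iff_continuousAt.2 fun t => ?_
  have h1 : (fun s => transport c s u) = fun s => transport c t (transport c (s - t) u) := by
    ext1 s
    rw [← transport_add, add_sub_cancel]
  rw [ContinuousAt, h1]
  have h2 : Tendsto (fun s : ℝ => s - t) (𝓝 t) (𝓝 0) := by
    simpa using (continuous_sub_right t).tendsto t
  have h3 := ((transport c t).continuous.tendsto u).comp (h0.comp h2)
  exact h3

lemma isIsometryGroup_transport : IsIsometryGroup (transport c : ℝ → L2Field n m →L[ℝ] _) where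
  zero := transport_zero c
  add := transport_add c
  norm_map := norm_transport c
  continuous := continuous_transport c

lemma hasDerivAt_transport_testL2 (φ : 𝓢(Space n, State m)) (t : ℝ) :
    HasDerivAt (fun s => transport c s (testL2 φ)) (-transport c t (testL2 (advect c φ))) t := by
  have h0 : HasDerivAt (fun s => transport c s (testL2 φ)) (-testL2 (advect c φ)) 0 := by
    rw [hasDerivAt_iff_isLittleO]
    refine Asymptotics.IsBigO.trans_isLittleO (g := fun s : ℝ => s ^ 2)
      (Asymptotics.IsBigO.of_bound (2 * ‖testL2 (advect c (advect c φ))‖)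
        (Eventually.of_forall fun s => ?_)) ?_
    · rw [transport_zero, sub_zero, smul_neg, sub_neg_eq_add, Real.norm_of_nonneg (sq_nonneg s)]
      exact (norm_transport_testL2_taylor_le c s φ).trans_eq (by ring)
    · simpa using Asymptotics.isLittleO_pow_id (𝕜 := ℝ) one_lt_two
  have h1 : HasDerivAt (fun s => transport c (s - t) (testL2 φ)) (-testL2 (advect c φ)) t := by
    have := HasDerivAt.comp_sub_const t t (f := fun s => transport c s (testL2 φ))
      (f' := -testL2 (advect c φ)) (by rwa [sub_self])
    exact this
  have h2 := (transport c t).hasFDerivAt.comp_hasDerivAt t h1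
  rw [map_neg] at h2
  refine h2.congr_of_eventuallyEq (Eventually.of_forall fun s => ?_)
  simp only [Function.comp]
  rw [← transport_add, add_sub_cancel]

end Transport

/-! ### Uniqueness for weakly formulated transport equations -/

section Uniqueness

variable (c : Fin m → Space n)

lemma testL2_advect_transportTest (t : ℝ) (φ : 𝓢(Space n, State m)) :
    testL2 (advect c (transportTest c t φ)) = transport c t (testL2 (advect c φ)) := by
  apply fourierL2_injective
  ext1
  filter_upwards [fourierL2_testL2_advect c (transportTest c t φ), fourierL2_testL2_advect c φ,
    fourierL2_transport c t (testL2 (advect c φ)), fourierL2_transport c t (testL2 φ)]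
    with ξ h1 h2 h3 h4
  rw [transport_testL2] at h4
  rw [h1, h3, h2, h4]
  ext i
  simp only [diag_apply]
  ring

lemma norm_le_of_forall_inner_testL2_le {z : L2Field n m} {b : ℝ} (hb : 0 ≤ b)
    (h : ∀ φ : 𝓢(Space n, State m), |inner ℝ z (testL2 φ)| ≤ b * ‖testL2 φ‖) : ‖z‖ ≤ b := by
  have h1 : |inner ℝ z z| ≤ b * ‖z‖ := by
    refine DenseRange.induction_on (p := fun x : L2Field n m => |inner ℝ z x| ≤ b * ‖x‖)
      (SchwartzMap.denseRange_toLpCLM (E := Space n) (F := State m) (p := 2)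
        ENNReal.ofNat_ne_top) z ?_ h
    exact isClosed_le (by fun_prop) (by fun_prop)
  rw [real_inner_self_eq_norm_sq, abs_of_nonneg (sq_nonneg _), sq] at h1
  rcases (norm_nonneg z).eq_or_lt with h2 | h2
  · rwa [← h2]
  · exact le_of_mul_le_mul_right h1 h2

/-- A product rule for `e` merely bounded: as `r` vanishes at `t`, no derivative of `e` appears and
only the pairing with the fixed vector `r'` has to be continuous. -/
lemma hasDerivWithinAt_inner_of_bounded {E : Type*} [NormedAddCommGroup E] [InnerProductSpace ℝ E]
    {e r : ℝ → E} {s : Set ℝ} {t C : ℝ} {r' : E} (he : ∀ τ ∈ s, ‖e τ‖ ≤ C)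
    (hr0 : r t = 0) (hr : HasDerivWithinAt r r' s t)
    (hc : ContinuousWithinAt (fun τ => inner ℝ (e τ) r') s t) :
    HasDerivWithinAt (fun τ => inner ℝ (e τ) (r τ)) (inner ℝ (e t) r') s t := by
  rw [hasDerivWithinAt_iff_isLittleO] at hr ⊢
  simp only [hr0, sub_zero, inner_zero_right] at hr ⊢
  have h1 : (fun τ => inner ℝ (e τ) (r τ - (τ - t) • r')) =o[𝓝[s] t] fun τ => τ - t := by
    refine Asymptotics.IsBigO.trans_isLittleO (Asymptotics.IsBigO.of_bound C ?_) hr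
    filter_upwards [self_mem_nhdsWithin] with τ hτ
    refine (norm_inner_le_norm _ _).trans ?_
    gcongr
    exact he τ hτ
  have h2 : (fun τ => (τ - t) * (inner ℝ (e τ) r' - inner ℝ (e t) r')) =o[𝓝[s] t]
      fun τ => τ - t := by
    have h3 : (fun τ => inner ℝ (e τ) r' - inner ℝ (e t) r') =o[𝓝[s] t] fun _ => (1 : ℝ) := by
      rw [Asymptotics.isLittleO_one_iff]
      simpa using hc.sub_const (inner ℝ (e t) r')
    simpa using (Asymptotics.isBigO_refl (fun τ : ℝ => τ - t) (𝓝[s] t)).mul_isLittleO h3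
  refine (h1.add h2).congr_left fun τ => ?_
  rw [inner_sub_right, inner_smul_right, smul_eq_mul]
  ring

/-- Along the characteristics the transport term disappears. -/
lemma hasDerivWithinAt_inner_transport {e F : ℝ → L2Field n m} {s : Set ℝ} {C : ℝ}
    (he : ∀ t ∈ s, ‖e t‖ ≤ C)
    (hd : ∀ φ : 𝓢(Space n, State m), ∀ t ∈ s, HasDerivWithinAt (fun τ => inner ℝ (e τ) (testL2 φ))
      (inner ℝ (e t) (testL2 (advect c φ)) + inner ℝ (F t) (testL2 φ)) s t)
    (φ : 𝓢(Space n, State m)) {t : ℝ} (ht : t ∈ s) :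
    HasDerivWithinAt (fun τ => inner ℝ (e τ) (transport c τ (testL2 φ)))
      (inner ℝ (F t) (transport c t (testL2 φ))) s t := by
  have h1 := hd (transportTest c t φ) t ht
  have hr : HasDerivWithinAt (fun τ => transport c τ (testL2 φ) - transport c t (testL2 φ))
      (-transport c t (testL2 (advect c φ))) s t :=
    ((hasDerivAt_transport_testL2 c φ t).sub_const _).hasDerivWithinAt
  have hc : ContinuousWithinAt
      (fun τ => inner ℝ (e τ) (-transport c t (testL2 (advect c φ)))) s t := by
    simp only [inner_neg_right, transport_testL2]
    exact (hd _ t ht).continuousWithinAt.neg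
  -- The moving test field is its value at `t`, handled by `h1`, plus an increment vanishing at `t`.
  -- The two advection terms cancel.
  have h2 := hasDerivWithinAt_inner_of_bounded he (sub_self _) hr hc
  rw [testL2_advect_transportTest, ← transport_testL2] at h1
  refine ((h1.add h2).congr_deriv ?_).congr_of_mem (fun τ _ => ?_) ht
  · rw [inner_neg_right]
    ring
  · simp only [Pi.add_apply, inner_sub_right]
    ring

/-- Grönwall's argument by duality: the hypotheses give no norm continuity of `e`, so scalar
functions are estimated, for one test field at a time carried along the characteristics, and the
supremum over test fields is taken at the end. -/
lemma eq_zero_of_weak_transport {T K C : ℝ} (hK : 0 ≤ K) {e F : ℝ → L2Field n m}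
    (he : ∀ t ∈ Icc 0 T, ‖e t‖ ≤ C) (he0 : e 0 = 0) (hF : ∀ t ∈ Icc 0 T, ‖F t‖ ≤ K * ‖e t‖)
    (hd : ∀ φ : 𝓢(Space n, State m), ∀ t ∈ Icc 0 T,
      HasDerivWithinAt (fun τ => inner ℝ (e τ) (testL2 φ))
        (inner ℝ (e t) (testL2 (advect c φ)) + inner ℝ (F t) (testL2 φ)) (Icc 0 T) t) :
    ∀ t ∈ Icc 0 T, e t = 0 := by
  intro t₀ ht₀
  have hT : (0 : ℝ) ∈ Icc 0 T := ⟨le_rfl, ht₀.1.trans ht₀.2⟩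
  have hC : 0 ≤ C := (norm_nonneg _).trans (he 0 hT)
  have hU := isIsometryGroup_transport c
  -- The rate `2K` is twice the Lipschitz constant, so integrating `K D e^{2Kτ}` gains a factor
  -- `1/2`. Iterating this improvement forces `e` to vanish.
  have step : ∀ D : ℝ, 0 ≤ D → (∀ t ∈ Icc 0 T, ‖e t‖ ≤ D * Real.exp (2 * K * t)) →
      ∀ t ∈ Icc 0 T, ‖e t‖ ≤ D / 2 * Real.exp (2 * K * t) := by
    intro D hD hbd t ht
    rw [← hU.norm_map (-t)]
    refine norm_le_of_forall_inner_testL2_le (by positivity) fun φ => ?_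
    rw [hU.inner_left, neg_neg, ← Real.norm_eq_abs]
    have hder := fun t ht => hasDerivWithinAt_inner_transport c he hd φ (t := t) ht
    refine image_norm_le_of_norm_deriv_right_le_deriv_boundary
      (f := fun τ => inner ℝ (e τ) (transport c τ (testL2 φ)))
      (f' := fun τ => inner ℝ (F τ) (transport c τ (testL2 φ)))
      (B := fun τ => D / 2 * Real.exp (2 * K * τ) * ‖testL2 φ‖)
      (B' := fun τ => D / 2 * (Real.exp (2 * K * τ) * (2 * K)) * ‖testL2 φ‖)
      (HasDerivWithinAt.continuousOn hder) (fun τ hτ => ?_) ?_ (fun τ => ?_) (fun τ hτ => ?_) ht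
    · exact (hder τ (Ico_subset_Icc_self hτ)).mono_of_mem_nhdsWithin (Icc_mem_nhdsGE_of_mem hτ)
    · rw [he0, inner_zero_left, norm_zero]
      positivity
    · have h1 : HasDerivAt (fun τ : ℝ => 2 * K * τ) (2 * K) τ := by
        simpa using (hasDerivAt_id τ).const_mul (2 * K)
      exact (h1.exp.const_mul _).mul_const _
    · have hτ' := Ico_subset_Icc_self hτ
      refine (norm_inner_le_norm _ _).trans ?_
      rw [hU.norm_map]
      gcongr
      calc ‖F τ‖ ≤ K * ‖e τ‖ := hF τ hτ'
        _ ≤ K * (D * Real.exp (2 * K * τ)) := by gcongr; exact hbd τ hτ'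
        _ = _ := by ring
  have iter : ∀ j : ℕ, ∀ t ∈ Icc 0 T, ‖e t‖ ≤ C / 2 ^ j * Real.exp (2 * K * t) := by
    intro j
    induction j with
    | zero =>
      intro t ht
      rw [pow_zero, div_one]
      refine (he t ht).trans (le_mul_of_one_le_right hC (Real.one_le_exp ?_))
      exact mul_nonneg (by positivity) ht.1
    | succ j ih =>
      intro t ht
      refine (step _ (by positivity) ih t ht).trans_eq ?_
      rw [pow_succ, div_div]
  have hlim : Tendsto (fun j : ℕ => C / 2 ^ j * Real.exp (2 * K * t₀)) atTop (𝓝 0) := by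
    have h1 : Tendsto (fun j : ℕ => ((1 : ℝ) / 2) ^ j) atTop (𝓝 0) :=
      tendsto_pow_atTop_nhds_zero_of_lt_one (by norm_num) (by norm_num)
    have h2 := (h1.const_mul C).mul_const (Real.exp (2 * K * t₀))
    simp only [mul_zero, zero_mul] at h2
    refine h2.congr fun j => ?_
    rw [one_div, inv_pow, div_eq_mul_inv]
  exact norm_le_zero_iff.1 (ge_of_tendsto' hlim fun j => iter j t₀ ht₀)

end Uniqueness

/-! ### Constant coefficient operators -/

lemma exists_complexification_linear (A : State m →L[ℝ] State m) :
    ∃ B : CState m →L[ℂ] CState m, ∀ x, B (stateToComplex m x) = stateToComplex m (A x) := by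
  let e : Fin m → State m := fun i => EuclideanSpace.single i 1
  let b : CState m →ₗ[ℂ] CState m :=
    { toFun := fun z => ∑ i, z i • stateToComplex m (A (e i))
      map_add' := fun z w => by simp [add_smul, Finset.sum_add_distrib]
      map_smul' := fun c z => by simp [mul_smul, Finset.smul_sum] }
  refine ⟨LinearMap.toContinuousLinearMap b, fun x => ?_⟩
  have hx : x = ∑ i, x i • e i := by
    ext j; simp [e, Pi.single_apply]
  have hc : ∀ (c : ℝ) (z : CState m), ((c : ℂ) • z) = c • z := fun c z => by
    ext j; simp
  change ∑ i, (stateToComplex m x) i • stateToComplex m (A (e i)) = _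
  conv_rhs => rw [hx]
  simp only [map_sum, map_smul, stateToComplex_apply, hc]

lemma fourier_compLp (A : CState m →L[ℂ] CState m) (h : CField n m) :
    𝓕 (A.compLp h) = A.compLp (𝓕 h) := by
  refine DenseRange.induction_on (p := fun h : CField n m => 𝓕 (A.compLp h) = A.compLp (𝓕 h))
    (SchwartzMap.denseRange_toLpCLM (E := Space n) (F := CState m) (p := 2)
      ENNReal.ofNat_ne_top) h ?_ ?_
  · exact isClosed_eq ((Lp.fourierTransformₗᵢ (Space n) (CState m)).continuous.comp
      (A.compLpL 2 volume).continuous)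
      ((A.compLpL 2 volume).continuous.comp (Lp.fourierTransformₗᵢ (Space n) (CState m)).continuous)
  · intro φ
    have h1 : A.compLp (φ.toLp 2 volume) = (φ.postcompCLM A).toLp 2 volume := by
      ext1
      filter_upwards [A.coeFn_compLp (φ.toLp 2 volume), φ.coeFn_toLp 2 volume,
        (φ.postcompCLM A).coeFn_toLp 2 volume] with x h1 h2 h3
      rw [h1, h2, h3, SchwartzMap.postcompCLM_apply]
    have h2 : ∀ ξ, 𝓕 (φ.postcompCLM A) ξ = A (𝓕 φ ξ) := fun ξ => by
      rw [SchwartzMap.fourier_coe, SchwartzMap.fourier_coe, Real.fourier_eq, Real.fourier_eq,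
        ← ContinuousLinearMap.integral_comp_comm]
      · congr 1 with x
        rw [SchwartzMap.postcompCLM_apply, Circle.smul_def, Circle.smul_def, map_smul]
      · exact (Real.fourierIntegral_convergent_iff _).2 φ.integrable
    rw [SchwartzMap.toLpCLM_apply, h1, SchwartzMap.toLp_fourier_eq, SchwartzMap.toLp_fourier_eq]
    ext1
    filter_upwards [A.coeFn_compLp ((𝓕 φ).toLp 2 volume), (𝓕 φ).coeFn_toLp 2 volume,
      (𝓕 (φ.postcompCLM A)).coeFn_toLp 2 volume] with ξ h3 h4 h5
    rw [h3, h4, h5, h2]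

lemma exists_fourierL2_compLpL (A : State m →L[ℝ] State m) :
    ∃ B : CState m →L[ℂ] CState m, ∀ u : L2Field n m,
      fourierL2 (A.compLpL 2 volume u) =ᵐ[volume] fun ξ => B (fourierL2 u ξ) := by
  obtain ⟨B, hB⟩ := exists_complexification_linear A
  refine ⟨B, fun u => ?_⟩
  have : (stateToComplex m).compLp (A.compLpL 2 volume u) =
      B.compLp ((stateToComplex m).compLp u) := by
    ext1
    filter_upwards [(stateToComplex m).coeFn_compLp (A.compLpL 2 volume u),
      A.coeFn_compLpL u, B.coeFn_compLp ((stateToComplex m).compLp u),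
      (stateToComplex m).coeFn_compLp u] with x h1 h2 h3 h4
    rw [h1, h2, h3, h4, hB]
  rw [fourierL2, this, fourier_compLp]
  exact B.coeFn_compLp _

/-- The weight is the same scalar in all components, so it commutes with a constant matrix. -/
lemma bessel_compLpL {l : ℝ} (hl : 0 ≤ l) (A : State m →L[ℝ] State m) (u : L2Field n m) :
    bessel hl (A.compLpL 2 volume u) = A.compLpL 2 volume (bessel hl u) := by
  obtain ⟨B, hB⟩ := exists_fourierL2_compLpL (n := n) A
  apply fourierL2_injective
  ext1
  have hc : ∀ (c : ℝ) (z : CState m), B (c • z) = c • B z := fun c z =>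
    (B.restrictScalars ℝ).map_smul c z
  filter_upwards [fourierL2_bessel hl (A.compLpL 2 volume u), hB u, hB (bessel hl u),
    fourierL2_bessel hl u] with ξ h1 h2 h3 h4
  rw [h1, h2, h3, h4, hc]

lemma inner_compLpL_left {A : State m →L[ℝ] State m}
    (hA : ∀ x y, inner ℝ (A x) y = inner ℝ x (A y)) (u v : L2Field n m) :
    inner ℝ (A.compLpL 2 volume u) v = inner ℝ u (A.compLpL 2 volume v) := by
  rw [L2.inner_def, L2.inner_def]
  refine integral_congr_ae ?_
  filter_upwards [A.coeFn_compLpL u, A.coeFn_compLpL v] with x h1 h2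
  rw [h1, h2, hA]

lemma inner_compLpL_nonneg {A : State m →L[ℝ] State m} (hA : ∀ x, 0 ≤ inner ℝ (A x) x)
    (u : L2Field n m) : 0 ≤ inner ℝ (A.compLpL 2 volume u) u := by
  rw [L2.inner_def]
  refine integral_nonneg_of_ae ?_
  filter_upwards [A.coeFn_compLpL u] with x h1
  rw [h1]
  exact hA _

/-! ### The structure of the nonlinearity -/

section Nonlinearity

variable {E : Type*} [NormedAddCommGroup E] [InnerProductSpace ℝ E] (P : E →L[ℝ] E)
  (G : E →L[ℝ] E →L[ℝ] E)

/-- The right-hand side `-ε⁻² P x + ε⁻¹ P G(x,x)`. -/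
def source (ε : ℝ) (x : E) : E := -((1 / ε ^ 2) • P x) + (1 / ε) • P (G x x)

variable {P}

/-- The energy estimate is uniform in `ε`. -/
lemma inner_source_le (hP : ∀ x y, inner ℝ (P x) y = inner ℝ x (P y))
    (hP0 : ∀ x, 0 ≤ inner ℝ (P x) x) (ε : ℝ) (x : E) :
    inner ℝ x (source P G ε x) ≤ ‖P‖ * ‖G‖ ^ 2 / 4 * ‖x‖ ^ 4 := by
  set g := G x x with hg
  -- Completing the square: nonnegativity of `P` at `x/ε - G(x,x)/2` bounds the singular terms by `¼
  -- ⟨P G(x,x), G(x,x)⟩`, and every power of `ε` is gone.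
  have h1 := hP0 ((1 / ε) • x - (1 / 2 : ℝ) • g)
  have h2 : inner ℝ (P ((1 / ε) • x - (1 / 2 : ℝ) • g)) ((1 / ε) • x - (1 / 2 : ℝ) • g) =
      1 / ε ^ 2 * inner ℝ x (P x) - 1 / ε * inner ℝ x (P g) + 1 / 4 * inner ℝ (P g) g := by
    simp only [map_sub, map_smul, inner_sub_left, inner_sub_right, inner_smul_left,
      inner_smul_right, conj_trivial]
    rw [hP x x, hP x g, real_inner_comm x (P g)]
    ring
  have h3 : inner ℝ (P g) g ≤ ‖P‖ * (‖G‖ * ‖x‖ * ‖x‖) ^ 2 := by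
    calc inner ℝ (P g) g ≤ ‖P g‖ * ‖g‖ := real_inner_le_norm _ _
      _ ≤ ‖P‖ * ‖g‖ * ‖g‖ := by gcongr; exact P.le_opNorm g
      _ = ‖P‖ * ‖g‖ ^ 2 := by ring
      _ ≤ _ := by gcongr; exact G.le_opNorm₂ x x
  have h4 : inner ℝ x (source P G ε x) =
      -(1 / ε ^ 2 * inner ℝ x (P x)) + 1 / ε * inner ℝ x (P g) := by
    rw [source, inner_add_right, inner_neg_right, inner_smul_right, inner_smul_right]
  rw [h4]
  rw [h2] at h1
  nlinarith

variable (P)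

lemma source_sub (ε : ℝ) (x y : E) : source P G ε x - source P G ε y =
    -((1 / ε ^ 2) • P (x - y)) + (1 / ε) • P (G (x - y) x + G y (x - y)) := by
  simp only [source, map_sub, map_add, sub_apply]
  module

lemma map_source_sub {J : E →L[ℝ] E} (hJ : ∀ x, J (P x) = P (J x)) (ε : ℝ) (x y : E) :
    J (source P G ε x - source P G ε y) =
      -((1 / ε ^ 2) • P (J (x - y))) + (1 / ε) • P (J (G (x - y) x) + J (G y (x - y))) := by
  rw [source_sub, map_add, map_neg, map_smul, map_smul, hJ, hJ, map_add J]

/-- The Lipschitz estimate for the seminorm `‖J x‖` on bounded sets. -/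
lemma exists_norm_map_source_sub_le {J : E →L[ℝ] E} (hJ : ∀ x, J (P x) = P (J x)) {a : ℝ}
    (ha : 0 ≤ a) (h1 : ∀ x y, ‖J (G x y)‖ ≤ a * ‖y‖ * ‖J x‖)
    (h2 : ∀ x y, ‖J (G x y)‖ ≤ a * ‖x‖ * ‖J y‖) {ε : ℝ} (hε : 0 < ε) (R : ℝ) : ∃ K : ℝ, 0 ≤ K ∧
    ∀ x y, ‖x‖ ≤ R → ‖y‖ ≤ R →
      ‖J (source P G ε x - source P G ε y)‖ ≤ K * ‖J (x - y)‖ := by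
  refine ⟨1 / ε ^ 2 * ‖P‖ + 1 / ε * (‖P‖ * (a * |R| + a * |R|)), by positivity,
    fun x y hx hy => ?_⟩
  have h3 : ‖J (G (x - y) x)‖ ≤ a * |R| * ‖J (x - y)‖ := by
    refine (h1 _ _).trans ?_
    gcongr
    exact hx.trans (le_abs_self R)
  have h4 : ‖J (G y (x - y))‖ ≤ a * |R| * ‖J (x - y)‖ := by
    refine (h2 _ _).trans ?_
    gcongr
    exact hy.trans (le_abs_self R)
  rw [map_source_sub P G hJ]
  calc _ ≤ 1 / ε ^ 2 * (‖P‖ * ‖J (x - y)‖) +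
        1 / ε * (‖P‖ * (a * |R| * ‖J (x - y)‖ + a * |R| * ‖J (x - y)‖)) := by
        refine (norm_add_le _ _).trans ?_
        rw [norm_neg, norm_smul, norm_smul, Real.norm_of_nonneg (by positivity),
          Real.norm_of_nonneg (by positivity)]
        gcongr
        · exact P.le_opNorm _
        · refine (P.le_opNorm _).trans ?_
          gcongr
          exact (norm_add_le _ _).trans (add_le_add h3 h4)
    _ = _ := by ring

/-- With `J` the identity this is the Lipschitz estimate in `H^l` needed for existence; its constant
may depend on `ε`. -/
lemma exists_norm_source_sub_le {ε : ℝ} (hε : 0 < ε) (R : ℝ) : ∃ K : ℝ, 0 ≤ K ∧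
    ∀ x y, ‖x‖ ≤ R → ‖y‖ ≤ R → ‖source P G ε x - source P G ε y‖ ≤ K * ‖x - y‖ :=
  exists_norm_map_source_sub_le P G (J := .id ℝ E) (fun _ => rfl) (norm_nonneg G)
    (fun x y => (G.le_opNorm₂ x y).trans_eq (mul_right_comm _ _ _)) (G.le_opNorm₂) hε R

end Nonlinearity

section BesselSource

variable {l : ℝ} (hl : 0 ≤ l)

/-- The Lipschitz estimate in `L²` on bounded subsets of `H^l`. -/
lemma exists_norm_bessel_source_sub_le (hln : (n : ℝ) / 2 < l) (A : State m →L[ℝ] State m)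
    {β : State m →L[ℝ] State m →L[ℝ] State m} {G : L2Field n m →L[ℝ] L2Field n m →L[ℝ] L2Field n m}
    (hG : ∀ h k, bessel hl (G h k) =ᵐ[volume] fun x => β (bessel hl h x) (bessel hl k x))
    {ε : ℝ} (hε : 0 < ε) (R : ℝ) : ∃ K : ℝ, 0 ≤ K ∧ ∀ h k, ‖h‖ ≤ R → ‖k‖ ≤ R →
      ‖bessel hl (source (A.compLpL 2 volume) G ε h - source (A.compLpL 2 volume) G ε k)‖ ≤
        K * ‖bessel hl (h - k)‖ := by
  obtain ⟨C, hC0, hC⟩ := exists_ae_norm_bessel_le (m := m) hl hln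
  -- The Sobolev embedding bounds one factor in `L^∞` by its `H^l` norm and leaves the other in
  -- `L²`.
  have h1 : ∀ h k, ‖bessel hl (G h k)‖ ≤ ‖β‖ * C * ‖k‖ * ‖bessel hl h‖ := fun h k => by
    refine Lp.norm_le_mul_norm_of_ae_le_mul ?_
    filter_upwards [hG h k, hC k] with x h1 h2
    rw [h1, mul_assoc ‖β‖, mul_right_comm]
    refine (β.le_opNorm₂ _ _).trans ?_
    gcongr
  have h2 : ∀ h k, ‖bessel hl (G h k)‖ ≤ ‖β‖ * C * ‖h‖ * ‖bessel hl k‖ := fun h k => by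
    refine Lp.norm_le_mul_norm_of_ae_le_mul ?_
    filter_upwards [hG h k, hC h] with x h1 h2
    rw [h1, mul_assoc ‖β‖]
    refine (β.le_opNorm₂ _ _).trans ?_
    gcongr
  exact exists_norm_map_source_sub_le _ G (bessel_compLpL hl A) (by positivity) h1 h2 hε R

end BesselSource

/-! ### The weak formulation in terms of the Bessel potential -/

lemma inner_testL2 (u : L2Field n m) (φ : 𝓢(Space n, State m)) :
    inner ℝ u (testL2 φ) = ∫ x, inner ℝ (u x) (φ x) := by
  rw [L2.inner_def]
  refine integral_congr_ae ?_
  filter_upwards [φ.coeFn_toLp 2 volume] with x h1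
  rw [testL2, h1]

lemma map_source {E : Type*} [NormedAddCommGroup E] [InnerProductSpace ℝ E] (P : E →L[ℝ] E)
    (G : E →L[ℝ] E →L[ℝ] E) {J : E →L[ℝ] E} (hJ : ∀ x, J (P x) = P (J x)) (ε : ℝ) (x : E) :
    J (source P G ε x) = -((1 / ε ^ 2) • P (J x)) + (1 / ε) • P (J (G x x)) := by
  rw [source, map_add, map_neg, map_smul, map_smul, hJ, hJ]

section WeakForm

variable {l : ℝ} (hl : 0 ≤ l) (B : Model n m) (M : State m) (ε : ℝ)
  {β : State m →L[ℝ] State m →L[ℝ] State m} {G : L2Field n m →L[ℝ] L2Field n m →L[ℝ] L2Field n m}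

/-- The linearized collision operator on fields. -/
def collision : L2Field n m →L[ℝ] L2Field n m :=
  (LinearMap.toContinuousLinearMap (B.lin M)).compLpL 2 volume

lemma coeFn_collision (u : L2Field n m) : collision B M u =ᵐ[volume] fun x => B.L M (u x) :=
  (LinearMap.toContinuousLinearMap (B.lin M)).coeFn_compLpL u

lemma bessel_collision (u : L2Field n m) :
    bessel hl (collision B M u) = collision B M (bessel hl u) := bessel_compLpL hl _ u

/-- Here the factorization `Γ = L ∘ β` returns to the original equation. -/
lemma coeFn_bessel_source (hβ : ∀ f g, B.L M (β f g) = B.Γ M f g)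
    (hG : ∀ h k, bessel hl (G h k) =ᵐ[volume] fun x => β (bessel hl h x) (bessel hl k x))
    (h : L2Field n m) :
    bessel hl (source (collision B M) G ε h) =ᵐ[volume] fun x =>
      -((1 / ε ^ 2) • B.L M (bessel hl h x)) +
        (1 / ε) • B.Γ M (bessel hl h x) (bessel hl h x) := by
  rw [map_source _ G (bessel_collision hl B M)]
  filter_upwards [coeFn_collision B M (bessel hl h), coeFn_collision B M (bessel hl (G h h)),
    hG h h, Lp.coeFn_add (-((1 / ε ^ 2) • collision B M (bessel hl h)))
      ((1 / ε) • collision B M (bessel hl (G h h))),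
    Lp.coeFn_neg ((1 / ε ^ 2) • collision B M (bessel hl h)),
    Lp.coeFn_smul (1 / ε ^ 2) (collision B M (bessel hl h)),
    Lp.coeFn_smul (1 / ε) (collision B M (bessel hl (G h h)))] with x h1 h2 h3 h4 h5 h6 h7
  rw [h4, Pi.add_apply, h5, Pi.neg_apply, h6, h7, Pi.smul_apply, Pi.smul_apply, h1, h2, h3, hβ]

lemma integral_weak_form (hβ : ∀ f g, B.L M (β f g) = B.Γ M f g)
    (hG : ∀ h k, bessel hl (G h k) =ᵐ[volume] fun x => β (bessel hl h x) (bessel hl k x))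
    (h : L2Field n m) (φ : 𝓢(Space n, State m)) :
    ∫ x, (1 / ε * ∑ i, bessel hl h x i * (fderiv ℝ φ x (B.v i)) i
        - 1 / ε ^ 2 * inner ℝ (B.L M (bessel hl h x)) (φ x)
        + 1 / ε * inner ℝ (B.Γ M (bessel hl h x) (bessel hl h x)) (φ x)) =
      inner ℝ (bessel hl h) (testL2 (advect (fun i => (1 / ε) • B.v i) φ)) +
        inner ℝ (bessel hl (source (collision B M) G ε h)) (testL2 φ) := by
  rw [L2.inner_def, L2.inner_def,
    ← integral_add (L2.integrable_inner _ _) (L2.integrable_inner _ _)]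
  refine integral_congr_ae ?_
  filter_upwards [(advect (fun i => (1 / ε) • B.v i) φ).coeFn_toLp 2 volume,
    φ.coeFn_toLp 2 volume, coeFn_bessel_source hl B M ε hβ hG h] with x h1 h2 h3
  rw [testL2, testL2, h1, h2, h3, inner_add_left, inner_neg_left, inner_smul_left, inner_smul_left,
    conj_trivial, conj_trivial, PiLp.inner_apply (bessel hl h x)]
  have h4 : ∀ i, inner ℝ (bessel hl h x i) (advect (fun i => (1 / ε) • B.v i) φ x i) =
      1 / ε * (bessel hl h x i * (fderiv ℝ φ x (B.v i)) i) := fun i => by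
    rw [advect_apply, map_smul, PiLp.smul_apply, smul_eq_mul, real_inner_eq_re_inner]
    simp
    ring
  simp only [h4, ← Finset.mul_sum]
  ring

/-- No regularity of `h` in time is assumed, so this applies both to the constructed solution and to
preimages of an arbitrary one. -/
lemma isWeakSolution_iff (hβ : ∀ f g, B.L M (β f g) = B.Γ M f g)
    (hG : ∀ h k, bessel hl (G h k) =ᵐ[volume] fun x => β (bessel hl h x) (bessel hl k x))
    {T : ℝ} {f₀ : L2Field n m} {u h : ℝ → L2Field n m} (hu : ∀ t ∈ Icc 0 T, bessel hl (h t) = u t) :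
    IsWeakSolution B M ε T f₀ u ↔ u 0 = f₀ ∧ ∀ φ : 𝓢(Space n, State m), ∀ t ∈ Icc 0 T,
      HasDerivWithinAt (fun s => inner ℝ (u s) (testL2 φ))
        (inner ℝ (u t) (testL2 (advect (fun i => (1 / ε) • B.v i) φ)) +
          inner ℝ (bessel hl (source (collision B M) G ε (h t))) (testL2 φ)) (Icc 0 T) t := by
  have key : ∀ φ : 𝓢(Space n, State m), ∀ t ∈ Icc 0 T, _ := fun φ t ht =>
    hu t ht ▸ integral_weak_form hl B M ε hβ hG (h t) φ
  constructor
  · intro H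
    refine ⟨H.initial, fun φ t ht => ?_⟩
    simp only [inner_testL2 _ φ]
    rw [← inner_testL2 _ φ, ← key φ t ht]
    exact H.equation φ t ht
  · rintro ⟨H0, H⟩
    refine ⟨H0, fun φ t ht => ?_⟩
    rw [key φ t ht]
    simpa only [inner_testL2 _ φ] using H φ t ht

end WeakForm

/-! ### Existence and uniqueness -/

section Solution

variable {l : ℝ} (hl : 0 ≤ l) {B : Model n m} {M : State m}
  {β : State m →L[ℝ] State m →L[ℝ] State m} {G : L2Field n m →L[ℝ] L2Field n m →L[ℝ] L2Field n m}

/-- The group is moved onto the test field, where it is differentiable; the field itself need not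
lie in the domain of the generator. -/
lemma hasDerivWithinAt_inner_bessel_transport (c : Fin m → Space n) {w : ℝ → L2Field n m}
    {s : Set ℝ} {t : ℝ} {z : L2Field n m} (hw : HasDerivWithinAt w (transport c (-t) z) s t)
    (ht : t ∈ s) (φ : 𝓢(Space n, State m)) :
    HasDerivWithinAt (fun τ => inner ℝ (bessel hl (transport c τ (w τ))) (testL2 φ))
      (inner ℝ (bessel hl (transport c t (w t))) (testL2 (advect c φ)) +
        inner ℝ (bessel hl z) (testL2 φ)) s t := by
  have hU := isIsometryGroup_transport (n := n) c
  have h1 : HasDerivAt (fun τ => transport c (-τ) (testL2 φ))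
      (transport c (-t) (testL2 (advect c φ))) t :=
    ((hasDerivAt_transport_testL2 c φ (-t)).scomp t (hasDerivAt_neg t)).congr_deriv
      (by rw [neg_one_smul, neg_neg])
  have h2 : HasDerivWithinAt (fun τ => bessel hl (w τ)) (bessel hl (transport c (-t) z)) s t :=
    (bessel hl).hasFDerivAt.comp_hasDerivWithinAt t hw
  refine ((h2.inner ℝ h1.hasDerivWithinAt).congr_deriv ?_).congr_of_mem (fun τ _ => ?_) ht
  · rw [← transport_bessel, ← transport_bessel, hU.inner_map_map, ← hU.inner_left]
  · rw [← transport_bessel, hU.inner_left]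

lemma inner_collision_left (hB : B.SymmetricRates) (hM : B.IsMaxwellian M) (u v : L2Field n m) :
    inner ℝ (collision B M u) v = inner ℝ u (collision B M v) :=
  inner_compLpL_left (A := LinearMap.toContinuousLinearMap (B.lin M)) (Model.L_isSymmetric hB hM)
    u v

lemma inner_collision_nonneg (hB : B.SymmetricRates) (hM : B.IsMaxwellian M) (u : L2Field n m) :
    0 ≤ inner ℝ (collision B M u) u :=
  inner_compLpL_nonneg (A := LinearMap.toContinuousLinearMap (B.lin M))
    (Model.inner_L_nonneg hB hM) u

lemma exists_weak_transport_solution (c : Fin m → Space n) {N : L2Field n m → L2Field n m}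
    (hN : ∀ R, ∃ K, 0 ≤ K ∧ ∀ x y, ‖x‖ ≤ R → ‖y‖ ≤ R → ‖N x - N y‖ ≤ K * ‖x - y‖) {C : ℝ}
    (hC : 0 ≤ C) (hE : ∀ x, inner ℝ x (N x) ≤ C * ‖x‖ ^ 4) (x₀ : L2Field n m) :
    ∃ h : ℝ → L2Field n m, h 0 = x₀ ∧ ContinuousOn h (Icc 0 (lifeSpan C ‖x₀‖)) ∧
      (∀ t ∈ Icc 0 (lifeSpan C ‖x₀‖), ‖h t‖ ≤ ‖x₀‖ + 1) ∧
      ∀ φ : 𝓢(Space n, State m), ∀ t ∈ Icc 0 (lifeSpan C ‖x₀‖),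
        HasDerivWithinAt (fun s => inner ℝ (bessel hl (h s)) (testL2 φ))
          (inner ℝ (bessel hl (h t)) (testL2 (advect c φ)) +
            inner ℝ (bessel hl (N (h t))) (testL2 φ)) (Icc 0 (lifeSpan C ‖x₀‖)) t := by
  obtain ⟨w, hw0, hw, hwb⟩ := exists_mild_solution (isIsometryGroup_transport c) hN hC hE x₀
  refine ⟨fun t => transport c t (w t), by simp only [transport_zero, hw0],
    (isIsometryGroup_transport c).continuousOn_apply continuousOn_id
      (HasDerivWithinAt.continuousOn hw),
    fun t ht => (norm_transport c t _).trans_le (hwb t ht), fun φ t ht => ?_⟩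
  exact hasDerivWithinAt_inner_bessel_transport hl c (hw t ht) ht φ

lemma exists_bessel_solution (hB : B.SymmetricRates) (hM : B.IsMaxwellian M)
    (hβ : ∀ f g, B.L M (β f g) = B.Γ M f g)
    (hG : ∀ h k, bessel hl (G h k) =ᵐ[volume] fun x => β (bessel hl h x) (bessel hl k x))
    {ε T : ℝ} (hε : 0 < ε) (x₀ : L2Field n m)
    (hT : T = lifeSpan (‖(collision B M : L2Field n m →L[ℝ] _)‖ * ‖G‖ ^ 2 / 4) ‖x₀‖) :
    ∃ h : ℝ → L2Field n m, ContinuousOn h (Icc 0 T) ∧ (∀ t ∈ Icc 0 T, ‖h t‖ ≤ ‖x₀‖ + 1) ∧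
      IsWeakSolution B M ε T (bessel hl x₀) fun t => bessel hl (h t) := by
  obtain ⟨h, h0, hc, hb, hd⟩ := exists_weak_transport_solution hl (fun i => (1 / ε) • B.v i)
    (exists_norm_source_sub_le (collision B M) G hε) (by positivity)
    (inner_source_le G (inner_collision_left hB hM) (inner_collision_nonneg hB hM) ε) x₀
  rw [← hT] at hc hb hd
  exact ⟨h, hc, hb, (isWeakSolution_iff hl B M ε hβ hG fun _ _ => rfl).2
    ⟨congrArg (bessel hl) h0, hd⟩⟩

/-- The difference solves a linear weak transport equation whose source is bounded in `L²` by a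
multiple of the difference, since both solutions stay in a fixed ball of `H^l`. -/
lemma IsWeakSolution.eqOn (hln : (n : ℝ) / 2 < l) (hβ : ∀ f g, B.L M (β f g) = B.Γ M f g)
    (hG : ∀ h k, bessel hl (G h k) =ᵐ[volume] fun x => β (bessel hl h x) (bessel hl k x))
    {ε T : ℝ} (hε : 0 < ε) {f₀ : L2Field n m} {f g : ℝ → L2Field n m}
    (hf : IsWeakSolution B M ε T f₀ f) (hfb : BoundedInH l T f)
    (hg : IsWeakSolution B M ε T f₀ g) (hgb : BoundedInH l T g) : EqOn g f (Icc 0 T) := by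
  have lift : ∀ {u : ℝ → L2Field n m}, BoundedInH l T u → ∃ (R : ℝ) (h : ℝ → L2Field n m),
      (∀ t ∈ Icc 0 T, bessel hl (h t) = u t) ∧ ∀ t ∈ Icc 0 T, ‖h t‖ ≤ R := by
    rintro u ⟨K, hK⟩
    choose! h hh using fun t (ht : t ∈ Icc 0 T) =>
      exists_bessel_eq hl ((hK t ht).trans_lt ENNReal.coe_lt_top)
    refine ⟨K, h, hh, fun t ht => ?_⟩
    have := hK t ht
    rw [← hh t ht, sobolevNorm_bessel] at this
    exact_mod_cast this
  obtain ⟨R, p, hp, hpR⟩ := lift hfb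
  obtain ⟨R', q, hq, hqR⟩ := lift hgb
  obtain ⟨K, hK0, hK⟩ := exists_norm_bessel_source_sub_le hl hln
    (LinearMap.toContinuousLinearMap (B.lin M)) hG hε (max R R')
  have hf' := ((isWeakSolution_iff hl B M ε hβ hG hp).1 hf)
  have hg' := ((isWeakSolution_iff hl B M ε hβ hG hq).1 hg)
  have h0 := eq_zero_of_weak_transport (fun i => (1 / ε) • B.v i) (T := T) (C := R' + R)
    (e := fun t => g t - f t) (F := fun t => bessel hl
      (source (collision B M) G ε (q t) - source (collision B M) G ε (p t))) hK0
    (fun t ht => ?_) (by rw [hf'.1, hg'.1, sub_self]) (fun t ht => ?_) fun φ t ht => ?_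
  · exact fun t ht => sub_eq_zero.1 (h0 t ht)
  · rw [← hp t ht, ← hq t ht]
    exact (norm_sub_le _ _).trans (add_le_add ((norm_bessel_le hl _).trans (hqR t ht))
      ((norm_bessel_le hl _).trans (hpR t ht)))
  · rw [← hp t ht, ← hq t ht, ← map_sub]
    exact hK _ _ ((hqR t ht).trans (le_max_right _ _)) ((hpR t ht).trans (le_max_left _ _))
  · refine (((hg'.2 φ t ht).sub (hf'.2 φ t ht)).congr_deriv ?_).congr_of_mem (fun s _ => ?_) ht
    · rw [map_sub, inner_sub_left, inner_sub_left]
      ring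
    · rw [inner_sub_left, Pi.sub_apply]

/-- Continuity of `h` in `L²` is continuity in `H^l`, which is stronger than required. -/
lemma continuousInH_bessel {T : ℝ} {h : ℝ → L2Field n m} (hh : ContinuousOn h (Icc 0 T)) :
    ContinuousInH (l - 1) T fun t => bessel hl (h t) := by
  have hle : ∀ z : L2Field n m, sobolevNorm (l - 1) (bessel hl z) ≤ ‖z‖ₑ := fun z =>
    (sobolevNorm_mono (sub_le_self l zero_le_one) _).trans_eq (sobolevNorm_bessel hl z)
  refine ⟨fun t _ => (hle _).trans_lt enorm_lt_top, fun t ht => ?_⟩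
  have h1 : Tendsto (fun s => ‖h s - h t‖ₑ) (𝓝[Icc 0 T] t) (𝓝 0) := by
    have := ((hh t ht).sub_const (h t)).enorm
    simpa using this
  refine tendsto_of_tendsto_of_tendsto_of_le_of_le tendsto_const_nhds h1
    (fun _ => zero_le) fun s => ?_
  simp only [← map_sub]
  exact hle _

end Solution
end DiscreteBoltzmann

end

open DiscreteBoltzmann
theorem theorem1 (n m : ℕ) (hn : 1 ≤ n) (B : Model n m) (hB : B.SymmetricRates)
    (M : State m) (hM : B.IsMaxwellian M) (l : ℝ) (hl : (n : ℝ) / 2 < l) :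
    ∃ T₀ k : ℝ → ℝ, (∀ r, 0 < T₀ r ∧ 0 < k r) ∧
      ∀ f₀ : L2Field n m, MemH l f₀ → ∀ ε : ℝ, 0 < ε →
        ∃ f : ℝ → L2Field n m,
          IsSolutionInClass B M l ε (T₀ (sobolevNorm l f₀).toReal) f₀ f ∧
          (∀ t ∈ Set.Icc 0 (T₀ (sobolevNorm l f₀).toReal),
            sobolevNorm l (f t) ≤ ENNReal.ofReal (k (sobolevNorm l f₀).toReal)) ∧
          ∀ g : ℝ → L2Field n m,
            IsSolutionInClass B M l ε (T₀ (sobolevNorm l f₀).toReal) f₀ g →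
            Set.EqOn g f (Set.Icc 0 (T₀ (sobolevNorm l f₀).toReal)) := by
  have hl0 : 0 ≤ l := (show (0 : ℝ) ≤ n / 2 by positivity).trans hl.le
  obtain ⟨β, hβ⟩ := Model.exists_gamma_eq_lin_comp hB hM
  obtain ⟨G, hG⟩ := exists_bilinear_lift (n := n) hl0 hl β
  -- The constant comes from the energy estimate and involves only the collision operator and `G`,
  -- both fixed before `f₀` and `ε`.
  refine ⟨lifeSpan (‖(collision B M : L2Field n m →L[ℝ] _)‖ * ‖G‖ ^ 2 / 4), fun r => |r| + 1,
    fun r => ⟨lifeSpan_pos (by positivity) r, by positivity⟩, fun f₀ hf₀ ε hε => ?_⟩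
  -- Replacing `f₀` by its preimage turns `‖f₀‖_l` into `‖x₀‖`, on which the life span is based.
  obtain ⟨x₀, rfl⟩ := exists_bessel_eq hl0 hf₀
  rw [sobolevNorm_bessel, toReal_enorm]
  generalize hT : lifeSpan (‖(collision B M : L2Field n m →L[ℝ] _)‖ * ‖G‖ ^ 2 / 4) ‖x₀‖ = T
  obtain ⟨h, hc, hb, hw⟩ := exists_bessel_solution hl0 hB hM hβ hG hε x₀ hT.symm
  have hk : ∀ t ∈ Icc 0 T, sobolevNorm l (bessel hl0 (h t)) ≤ ENNReal.ofReal (|‖x₀‖| + 1) :=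
    fun t ht => by
      rw [sobolevNorm_bessel, ← ofReal_norm, abs_of_nonneg (norm_nonneg x₀)]
      exact ENNReal.ofReal_le_ofReal (hb t ht)
  have hbd : BoundedInH l T fun t => bessel hl0 (h t) := ⟨(|‖x₀‖| + 1).toNNReal, hk⟩
  exact ⟨fun t => bessel hl0 (h t), ⟨hbd, continuousInH_bessel hl0 hc, hw⟩, hk,
    fun g hg => hw.eqOn hl0 hl hβ hG hε hbd hg.solves hg.bounded⟩
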